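/- Let $g$ be a finite simple undirected graph and let $\vec g$ be its symmetric digraph, obtained by orienting each edge in both directions. The girth of $g$ is the minimum length of its cycles ($\infty$ if $g$ has no cycle). For a finite digraph $G$ with directed path metric $d$ (where $d(x,y)=\infty$ if there is no directed path from $x$ to $y$) and $k\ge -1$, let $R_k(G)$ be the free abelian group on the tuples $(x_0,\dots,x_k)$ of vertices with $x_m\ne x_{m+1}$ for all $m$ (for $k=-1$, on the single empty tuple), and let $R_k(G)=0$ for $k\le -2$. Let $\partial_k:R_k(G)\to R_{k-1}(G)$ be $\partial_k(x_0,\dots,x_k)=\sum_{m=0}^{k}(-1)^m(x_0,\dots,\check x_m,\dots,x_k)$, where faces with two equal consecutive entries are set to $0$. The length of a tuple is $L(x_0,\dots,x_k)=\sum_{m=0}^{k-1}d(x_m,x_{m+1})$ for $k\ge 0$, and $-1$ for the empty tuple; $(-)^{\ell}$ denotes the projection of $R_k(G)$ onto the span $MC^\ell_k(G)$ of the tuples of length $\ell$. For $k,\ell\in\mathbb Z$, the magnitude homology $MH^\ell_k(G)$ is the homology at $MC^\ell_k(G)$ of the complex $(MC^\ell_*(G),\ x\mapsto(\partial x)^\ell)$.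 The map $x\mapsto(\partial_k x)^{\ell-1}$ induces homomorphisms $\partial'^{\ell}_k:MH^\ell_k(G)\to MH^{\ell-1}_{k-1}(G)$ with $\partial'^{\ell-1}_{k-1}\circ\partial'^{\ell}_k=0$, and $dMH^\ell_k(G)=\ker\partial'^{\ell}_k/\operatorname{im}\partial'^{\ell+1}_{k+1}$. **Proposition.** Let $\ell\ge 1$ and $i\ge 0$ be integers and suppose that the girth of $g$ is at least $2i+5$. Then: 1. if $\ell\ge 2$, then $dMH^\ell_\ell(\vec g)=0$; 2. $dMH^\ell_{\ell-j}(\vec g)=0$ for every integer $j$ with $1\le j\le i$; 3. if moreover the girth of $g$ is finite (i.e. $g$ contains a cycle), then $dMH^1_1(\vec g)\ne 0$. -/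

import Mathlib

/-- The symmetric digraph of an undirected graph: each edge is oriented in both directions. -/
def SimpleGraph.symmDigraph {V : Type*} (g : SimpleGraph V) : Digraph V where
  Adj := g.Adj

namespace PathMag

section Chains

variable {V : Type*}

/-! Tuples of vertices are lists: `(x_0, …, x_k)` is a list of length `k + 1`, and the empty list
is the unique tuple with `k = -1`. The free module `List V →₀ ℤ` is the direct sum of all the
modules `Λ_k`, `k ∈ ℤ`, where `Λ_k` is spanned by the lists `x` with `(x.length : ℤ) = k + 1`. -/

/-- The projection of a free module onto the span of the basis elements in `s`, which sends all
the other basis elements to zero. -/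
noncomputable def proj (s : Set (List V)) : (List V →₀ ℤ) →ₗ[ℤ] (List V →₀ ℤ) :=
  letI := Classical.decPred (· ∈ s)
  (Finsupp.supported ℤ ℤ s).subtype ∘ₗ Finsupp.restrictDom ℤ ℤ s

/-- The alternating sum of the faces of a tuple. -/
noncomputable def faceSum (x : List V) : List V →₀ ℤ :=
  ∑ i ∈ Finset.range x.length, Finsupp.single (x.eraseIdx i) ((-1 : ℤ) ^ i)

/-- The boundary map `Λ_k → Λ_{k-1}`, for all `k` together. -/
noncomputable def preBoundary : (List V →₀ ℤ) →ₗ[ℤ] (List V →₀ ℤ) :=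
  Finsupp.linearCombination ℤ faceSum

/-- The regular tuples: consecutive entries differ. The other tuples span the submodule `I` of
degenerate chains. -/
def regularTuples (V : Type*) : Set (List V) := {x | x.IsChain (· ≠ ·)}

/-- The boundary map of the quotient `R = Λ / I`, where `R` is identified with the span of the
regular tuples: degenerate faces are zero. -/
noncomputable def boundary : (List V →₀ ℤ) →ₗ[ℤ] (List V →₀ ℤ) :=
  proj (regularTuples V) ∘ₗ preBoundary

theorem proj_single_mem {s : Set (List V)} {x : List V} (h : x ∈ s) (c : ℤ) :
    proj s (Finsupp.single x c) = Finsupp.single x c := by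
  classical
  simp only [proj, LinearMap.comp_apply, Submodule.subtype_apply, Finsupp.restrictDom_apply]
  exact Finsupp.filter_single_of_pos _ h

theorem proj_single_notMem {s : Set (List V)} {x : List V} (h : x ∉ s) (c : ℤ) :
    proj s (Finsupp.single x c) = 0 := by
  classical
  simp only [proj, LinearMap.comp_apply, Submodule.subtype_apply, Finsupp.restrictDom_apply]
  exact Finsupp.filter_single_of_neg _ h

theorem proj_apply (s : Set (List V)) (u : List V →₀ ℤ) (x : List V) [Decidable (x ∈ s)] :
    proj s u x = if x ∈ s then u x else 0 := by
  classical
  simp only [proj, LinearMap.comp_apply, Submodule.subtype_apply, Finsupp.restrictDom_apply,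
    Finsupp.filter_apply]
  split_ifs <;> rfl

theorem proj_mem (s : Set (List V)) (u : List V →₀ ℤ) :
    proj s u ∈ Finsupp.supported ℤ ℤ s := by
  classical
  rw [Finsupp.mem_supported']
  intro x hx
  simp [proj_apply, hx]

theorem proj_mem_of_mem (s : Set (List V)) {t : Set (List V)} {u : List V →₀ ℤ}
    (h : u ∈ Finsupp.supported ℤ ℤ t) : proj s u ∈ Finsupp.supported ℤ ℤ t := by
  classical
  rw [Finsupp.mem_supported'] at h ⊢
  intro x hx
  simp [proj_apply, h x hx]

theorem sub_proj_mem {s t t' : Set (List V)} (hs : ∀ x ∈ t, x ∉ s → x ∈ t') {u : List V →₀ ℤ}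
    (h : u ∈ Finsupp.supported ℤ ℤ t) : u - proj s u ∈ Finsupp.supported ℤ ℤ t' := by
  classical
  rw [Finsupp.mem_supported'] at h ⊢
  intro x hx
  rw [Finsupp.sub_apply, proj_apply]
  split_ifs with h1
  · simp
  · rw [h x (fun h2 => hx (hs x h2 h1))]; simp

theorem proj_eq_zero {s t : Set (List V)} (hs : ∀ x ∈ t, x ∉ s) {u : List V →₀ ℤ}
    (h : u ∈ Finsupp.supported ℤ ℤ t) : proj s u = 0 := by
  classical
  rw [Finsupp.mem_supported'] at h
  ext x
  rw [proj_apply]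
  split_ifs with h1
  · exact h x (fun h2 => hs x h2 h1)
  · rfl

/-- A linear map sends chains supported in `s` to chains supported in `t` if it does so on the
basis. -/
theorem map_supported {s t : Set (List V)} (f : (List V →₀ ℤ) →ₗ[ℤ] (List V →₀ ℤ))
    (h : ∀ x ∈ s, f (Finsupp.single x 1) ∈ Finsupp.supported ℤ ℤ t) {u : List V →₀ ℤ}
    (hu : u ∈ Finsupp.supported ℤ ℤ s) : f u ∈ Finsupp.supported ℤ ℤ t := by
  rw [Finsupp.supported_eq_span_single] at hu
  refine Submodule.span_induction (p := fun u _ => f u ∈ Finsupp.supported ℤ ℤ t) ?_ ?_ ?_ ?_ hu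
  · rintro _ ⟨x, hx, rfl⟩
    exact h x hx
  · simp
  · intro x y _ _ hx hy
    rw [map_add]; exact add_mem hx hy
  · intro c x _ hx
    rw [map_smul]; exact Submodule.smul_mem _ c hx

/-- Prepending a vertex to a tuple. -/
noncomputable def consMap (x : V) : (List V →₀ ℤ) →ₗ[ℤ] (List V →₀ ℤ) :=
  Finsupp.lmapDomain ℤ ℤ (List.cons x)

theorem preBoundary_single (x : List V) : preBoundary (Finsupp.single x 1) = faceSum x := by
  simp [preBoundary]

theorem preBoundary_nil : preBoundary (Finsupp.single ([] : List V) 1) = 0 := by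
  simp [preBoundary_single, faceSum]

theorem preBoundary_cons_single (x : V) (l : List V) :
    preBoundary (Finsupp.single (x :: l) 1) =
      Finsupp.single l 1 - consMap x (preBoundary (Finsupp.single l 1)) := by
  simp only [preBoundary_single, faceSum, List.length_cons, Finset.sum_range_succ', map_sum]
  simp only [List.eraseIdx_cons_succ, List.eraseIdx_zero, List.tail_cons, pow_zero, pow_succ,
    consMap, Finsupp.lmapDomain_apply, Finsupp.mapDomain_single]
  rw [add_comm, sub_eq_add_neg, ← Finset.sum_neg_distrib]
  simp

theorem preBoundary_cons (x : V) (u : List V →₀ ℤ) :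
    preBoundary (consMap x u) = u - consMap x (preBoundary u) := by
  have : preBoundary ∘ₗ consMap x = LinearMap.id - consMap x ∘ₗ preBoundary := by
    refine Finsupp.lhom_ext' fun l => LinearMap.ext_ring ?_
    simp only [LinearMap.comp_apply, Finsupp.lsingle_apply, LinearMap.sub_apply, LinearMap.id_apply]
    rw [← preBoundary_cons_single]
    simp [consMap, Finsupp.mapDomain_single]
  exact LinearMap.congr_fun this u

theorem preBoundary_preBoundary (u : List V →₀ ℤ) : preBoundary (preBoundary u) = 0 := by
  have : (preBoundary ∘ₗ preBoundary : (List V →₀ ℤ) →ₗ[ℤ] _) = 0 := by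
    refine Finsupp.lhom_ext' fun l => LinearMap.ext_ring ?_
    simp only [LinearMap.comp_apply, Finsupp.lsingle_apply, LinearMap.zero_apply]
    induction l with
    | nil => simp [preBoundary_nil]
    | cons x l ih => rw [preBoundary_cons_single, map_sub, preBoundary_cons, ih]; simp
  exact LinearMap.congr_fun this u

theorem consMap_mem {s t : Set (List V)} (x : V) (h : ∀ l ∈ s, x :: l ∈ t) {u : List V →₀ ℤ}
    (hu : u ∈ Finsupp.supported ℤ ℤ s) : consMap x u ∈ Finsupp.supported ℤ ℤ t := by
  refine map_supported _ (fun l hl => ?_) hu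
  simp only [consMap, Finsupp.lmapDomain_apply, Finsupp.mapDomain_single]
  exact Finsupp.single_mem_supported ℤ _ (h l hl)

/-- The boundary of a degenerate chain is degenerate. -/
theorem preBoundary_degenerate {u : List V →₀ ℤ}
    (hu : u ∈ Finsupp.supported ℤ ℤ (regularTuples V)ᶜ) :
    preBoundary u ∈ Finsupp.supported ℤ ℤ (regularTuples V)ᶜ := by
  refine map_supported _ (fun l hl => ?_) hu
  have hc : ∀ (x : V), ∀ l ∈ (regularTuples V)ᶜ, x :: l ∈ (regularTuples V)ᶜ := by
    intro x l hl h
    exact hl (List.IsChain.tail h)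
  induction l with
  | nil => exact absurd List.IsChain.nil hl
  | cons x l ih =>
    by_cases hl' : l ∈ (regularTuples V)ᶜ
    · rw [preBoundary_cons_single]
      exact sub_mem (Finsupp.single_mem_supported ℤ _ hl') (consMap_mem x (hc x) (ih hl'))
    · cases l with
      | nil => exact absurd (List.IsChain.singleton x) hl
      | cons y m =>
        have hxy : x = y := by
          by_contra hxy
          have hl'' : (y :: m).IsChain (· ≠ ·) := not_not.mp hl'
          exact hl (List.isChain_cons_cons.mpr ⟨hxy, hl''⟩)
        subst hxy
        rw [preBoundary_cons_single, preBoundary_cons_single, map_sub]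
        have : consMap x (Finsupp.single m 1) = Finsupp.single (x :: m) 1 := by
          simp [consMap, Finsupp.mapDomain_single]
        rw [this, sub_sub_cancel]
        have h2 : ∀ v : List V →₀ ℤ, v ∈ Finsupp.supported ℤ ℤ (Set.univ : Set (List V)) := by
          simp [Finsupp.supported_univ]
        refine consMap_mem (s := {l | ∃ l', l = x :: l'}) x ?_
          (consMap_mem (s := Set.univ) (t := {l | ∃ l', l = x :: l'}) x (fun l _ => ⟨l, rfl⟩) (h2 _))
        rintro _ ⟨l', rfl⟩ h
        exact (List.isChain_cons_cons.mp h).1 rfl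

theorem boundary_boundary (u : List V →₀ ℤ) : boundary (boundary u) = 0 := by
  have key : ∀ v : List V →₀ ℤ, boundary (proj (regularTuples V) v) = boundary v := by
    intro v
    have h1 : v - proj (regularTuples V) v ∈ Finsupp.supported ℤ ℤ (regularTuples V)ᶜ :=
      sub_proj_mem (t := Set.univ) (fun x _ hx => hx) (by simp [Finsupp.supported_univ])
    have h2 : boundary (v - proj (regularTuples V) v) = 0 :=
      proj_eq_zero (fun x hx => hx) (preBoundary_degenerate h1)
    rw [map_sub, sub_eq_zero] at h2
    exact h2.symm
  rw [boundary, LinearMap.comp_apply, LinearMap.comp_apply]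
  change boundary (proj (regularTuples V) (preBoundary u)) = 0
  rw [key, boundary, LinearMap.comp_apply, preBoundary_preBoundary, map_zero]

theorem boundary_mem {s t : Set (List V)} (h : ∀ x ∈ s, ∀ i < x.length, x.eraseIdx i ∈ t)
    {u : List V →₀ ℤ} (hu : u ∈ Finsupp.supported ℤ ℤ s) :
    boundary u ∈ Finsupp.supported ℤ ℤ t := by
  refine proj_mem_of_mem _ (map_supported _ (fun x hx => ?_) hu)
  rw [preBoundary_single, faceSum]
  exact sum_mem fun i hi =>
    Finsupp.single_mem_supported ℤ _ (h x hx i (Finset.mem_range.mp hi))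

end Chains

section Magnitude

variable {V : Type*} (G : Digraph V)

/-- The directed path metric: the least number of edges of a directed path from `x` to `y`
(zero if `x = y`), and `∞` if there is no such path. -/
noncomputable def pathDist (x y : V) : ℕ∞ :=
  ⨅ n ∈ {n : ℕ | ∃ p : ℕ → V, p 0 = x ∧ p n = y ∧ ∀ i < n, G.Adj (p i) (p (i + 1))}, (n : ℕ∞)

/-- The length `L` of a tuple: the sum of the distances between consecutive entries, and `-1` for
the empty tuple. -/
noncomputable def tupleLength : List V → WithTop ℤ
  | [] => ((-1 : ℤ) : WithTop ℤ)
  | [_] => 0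
  | x :: y :: l => ENat.map (fun n : ℕ => (n : ℤ)) (pathDist G x y) + tupleLength (y :: l)

/-- The component of length `ℓ` of a chain. -/
noncomputable def lengthPart (ℓ : ℤ) : (List V →₀ ℤ) →ₗ[ℤ] (List V →₀ ℤ) :=
  proj {x | tupleLength G x = (ℓ : WithTop ℤ)}

/-- The magnitude chain module `MC^ℓ_k(G)`, for `ℓ, k ∈ ℤ`: the free module on the regular tuples
`(x_0, …, x_k)` of length `ℓ`. -/
noncomputable def MC (ℓ k : ℤ) : Submodule ℤ (List V →₀ ℤ) :=
  Finsupp.supported ℤ ℤ {x : List V | (x.length : ℤ) = k + 1 ∧ x ∈ regularTuples V ∧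
    tupleLength G x = (ℓ : WithTop ℤ)}

theorem lengthPart_boundary_mem {k k' : ℤ} (hk : k' + 1 = k) (ℓ ℓ' : ℤ) {u : List V →₀ ℤ}
    (hu : u ∈ MC G ℓ k) : lengthPart G ℓ' (boundary u) ∈ MC G ℓ' k' := by
  have h1 : boundary u ∈ Finsupp.supported ℤ ℤ {x : List V | (x.length : ℤ) = k' + 1} := by
    refine boundary_mem (fun x hx i hi => ?_) hu
    have := hx.1
    simp only [Set.mem_ofPred_eq, List.length_eraseIdx_of_lt hi]
    omega
  have h2 : boundary u ∈ Finsupp.supported ℤ ℤ (regularTuples V) := proj_mem _ _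
  have h3 := proj_mem_of_mem {x | tupleLength G x = (ℓ' : WithTop ℤ)} h1
  have h4 := proj_mem_of_mem {x | tupleLength G x = (ℓ' : WithTop ℤ)} h2
  have h5 := proj_mem {x | tupleLength G x = (ℓ' : WithTop ℤ)} (boundary u)
  rw [Finsupp.mem_supported] at h3 h4 h5
  rw [MC, Finsupp.mem_supported]
  exact fun x hx => ⟨h3 hx, h4 hx, h5 hx⟩

/-- For `k' = k - 1`, the map `MC^ℓ_k(G) → MC^ℓ'_{k'}(G)`, `x ↦ (∂ x)^ℓ'`. -/
noncomputable def partialBoundary (ℓ ℓ' : ℤ) {k k' : ℤ} (hk : k' + 1 = k) :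
    MC G ℓ k →ₗ[ℤ] MC G ℓ' k' :=
  (lengthPart G ℓ' ∘ₗ boundary).restrict fun _ hu => lengthPart_boundary_mem G hk ℓ ℓ' hu

/-- The homology `ker g / im f` at `B` of a pair of composable maps `A → B → C`. -/
abbrev Homology {A B C : Type*} [AddCommGroup A] [AddCommGroup B] [AddCommGroup C]
    (f : A →ₗ[ℤ] B) (g : B →ₗ[ℤ] C) : Type _ :=
  LinearMap.ker g ⧸ (LinearMap.range f).submoduleOf (LinearMap.ker g)

/-- The differential `∂^ℓ_k : MC^ℓ_k(G) → MC^ℓ_{k-1}(G)` of the magnitude chain complex. -/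
noncomputable abbrev magBoundary (ℓ : ℤ) {k k' : ℤ} (hk : k' + 1 = k) :
    MC G ℓ k →ₗ[ℤ] MC G ℓ k' :=
  partialBoundary G ℓ ℓ hk

/-- The magnitude homology `MH^ℓ_k(G)`. -/
abbrev MH (ℓ k : ℤ) : Type _ :=
  Homology (magBoundary G ℓ (rfl : k + 1 = k + 1)) (magBoundary G ℓ (sub_add_cancel k 1))

/-! The lemmas below show that `∂'` induces a map on magnitude homology. -/

theorem pathDist_triangle (x y z : V) : pathDist G x z ≤ pathDist G x y + pathDist G y z := by
  have key : ∀ m n : ℕ,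
      (∃ p : ℕ → V, p 0 = x ∧ p m = y ∧ ∀ i < m, G.Adj (p i) (p (i + 1))) →
      (∃ p : ℕ → V, p 0 = y ∧ p n = z ∧ ∀ i < n, G.Adj (p i) (p (i + 1))) →
      pathDist G x z ≤ (m : ℕ∞) + n := by
    rintro m n ⟨p, hp0, hpm, hp⟩ ⟨q, hq0, hqn, hq⟩
    rw [← Nat.cast_add]
    refine iInf₂_le (m + n) ⟨fun i => if i < m then p i else q (i - m), ?_, ?_, ?_⟩
    · by_cases h : 0 < m
      · simp [h, hp0]
      · obtain rfl : m = 0 := by omega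
        simp [hq0, ← hpm, hp0]
    · simp [hqn]
    · intro i hi
      by_cases h1 : i + 1 < m
      · simp only [h1, show i < m by omega, if_true]
        exact hp i (by omega)
      · by_cases h2 : i < m
        · obtain rfl : m = i + 1 := by omega
          have := hp i (by omega)
          simpa [hpm, hq0] using this
        · simp only [h1, h2, if_false]
          have := hq (i - m) (by omega)
          rwa [show i - m + 1 = i + 1 - m by omega] at this
  by_cases h1 : pathDist G x y = ⊤
  · simp [h1]
  by_cases h2 : pathDist G y z = ⊤
  · simp [h2]
  have attained : ∀ a b : V, pathDist G a b ≠ ⊤ → ∃ n : ℕ, pathDist G a b = n ∧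
      ∃ p : ℕ → V, p 0 = a ∧ p n = b ∧ ∀ i < n, G.Adj (p i) (p (i + 1)) := by
    intro a b hab
    set S := {n : ℕ | ∃ p : ℕ → V, p 0 = a ∧ p n = b ∧ ∀ i < n, G.Adj (p i) (p (i + 1))} with hS
    have hne : S.Nonempty := by
      by_contra h
      rw [Set.not_nonempty_iff_eq_empty] at h
      apply hab
      rw [pathDist, ← hS, h]
      simp
    refine ⟨sInf S, ?_, Nat.sInf_mem hne⟩
    rw [pathDist, ← hS]
    exact le_antisymm (iInf₂_le _ (Nat.sInf_mem hne))
      (le_iInf₂ fun n hn => Nat.cast_le.mpr (Nat.sInf_le hn))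
  obtain ⟨m, hm, hpm⟩ := attained x y h1
  obtain ⟨n, hn, hpn⟩ := attained y z h2
  rw [hm, hn]
  exact key m n hpm hpn

theorem tupleLength_eraseIdx_le : ∀ (x : List V) (i : ℕ), i < x.length →
    tupleLength G (x.eraseIdx i) ≤ tupleLength G x := by
  have mono : ∀ a b : ℕ∞, a ≤ b →
      ENat.map (fun n : ℕ => (n : ℤ)) a ≤ ENat.map (fun n : ℕ => (n : ℤ)) b := by
    intro a b hab
    exact WithTop.monotone_map_iff.mpr Nat.mono_cast hab
  have addmap : ∀ a b : ℕ∞, ENat.map (fun n : ℕ => (n : ℤ)) (a + b) =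
      ENat.map (fun n : ℕ => (n : ℤ)) a + ENat.map (fun n : ℕ => (n : ℤ)) b := by
    intro a b
    exact WithTop.map_add (Nat.castAddMonoidHom ℤ) a b
  have nonneg : ∀ a : ℕ∞, 0 ≤ ENat.map (fun n : ℕ => (n : ℤ)) a := by
    intro a
    exact mono 0 a bot_le
  intro x
  induction x with
  | nil => intro i hi; simp at hi
  | cons x l ih =>
    intro i hi
    match l, i with
    | [], 0 =>
      simp only [List.eraseIdx_zero, List.tail_cons, tupleLength]
      exact WithTop.coe_le_coe.mpr (by norm_num : (-1 : ℤ) ≤ 0)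
    | [], i + 1 => simp at hi
    | y :: m, 0 =>
      simp only [List.eraseIdx_zero, List.tail_cons, tupleLength]
      exact le_add_of_nonneg_left (nonneg _)
    | [y], 1 =>
      simp only [List.eraseIdx_cons_succ, List.eraseIdx_zero, List.tail_cons, tupleLength]
      exact add_nonneg (nonneg _) le_rfl
    | y :: z :: m, 1 =>
      simp only [List.eraseIdx_cons_succ, List.eraseIdx_zero, List.tail_cons, tupleLength]
      rw [← add_assoc, ← addmap]
      exact add_le_add (mono _ _ (pathDist_triangle G x y z)) le_rfl
    | y :: m, i + 2 =>
      have := ih (i + 1) (by simpa using hi)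
      simp only [List.eraseIdx_cons_succ, tupleLength] at this ⊢
      exact add_le_add le_rfl this

/-- The filtration: chains supported on tuples of length at most `ℓ`. -/
noncomputable def lengthLE (ℓ : ℤ) : Submodule ℤ (List V →₀ ℤ) :=
  Finsupp.supported ℤ ℤ {x : List V | tupleLength G x ≤ (ℓ : WithTop ℤ)}

theorem boundary_lengthLE {ℓ : ℤ} {u : List V →₀ ℤ} (hu : u ∈ lengthLE G ℓ) :
    boundary u ∈ lengthLE G ℓ :=
  boundary_mem (fun x hx i hi => (tupleLength_eraseIdx_le G x i hi).trans hx) hu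

theorem MC_le_lengthLE (ℓ k : ℤ) : MC G ℓ k ≤ lengthLE G ℓ :=
  Finsupp.supported_mono fun _ hx => hx.2.2.le

theorem sub_lengthPart_mem {ℓ ℓ' : ℤ} (h : ℓ' + 1 = ℓ) {u : List V →₀ ℤ}
    (hu : u ∈ lengthLE G ℓ) : u - lengthPart G ℓ u ∈ lengthLE G ℓ' := by
  refine sub_proj_mem (fun x hx hne => ?_) hu
  have hlt : tupleLength G x < (ℓ : WithTop ℤ) := lt_of_le_of_ne hx hne
  obtain ⟨a, ha⟩ := WithTop.ne_top_iff_exists.mp (ne_top_of_lt hlt)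
  simp only [Set.mem_ofPred_eq]
  rw [← ha] at hlt ⊢
  rw [WithTop.coe_lt_coe] at hlt
  rw [WithTop.coe_le_coe]
  omega

theorem lengthPart_eq_zero {ℓ ℓ' : ℤ} (h : ℓ' + 1 = ℓ) {u : List V →₀ ℤ}
    (hu : u ∈ lengthLE G ℓ') : lengthPart G ℓ u = 0 := by
  refine proj_eq_zero (fun x hx hx' => ?_) hu
  simp only [Set.mem_ofPred_eq] at hx hx'
  rw [hx', WithTop.coe_le_coe] at hx
  omega

theorem lengthPart_boundary_lengthPart {ℓ : ℤ} {u : List V →₀ ℤ} (hu : u ∈ lengthLE G ℓ) :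
    lengthPart G ℓ (boundary (lengthPart G ℓ u)) = lengthPart G ℓ (boundary u) := by
  have h := boundary_lengthLE G (sub_lengthPart_mem G (sub_add_cancel ℓ 1) hu)
  have h2 := lengthPart_eq_zero G (sub_add_cancel ℓ 1) h
  rw [map_sub, map_sub, sub_eq_zero] at h2
  exact h2.symm

theorem magBoundary_magBoundary (ℓ : ℤ) {k k' k'' : ℤ} (hk : k' + 1 = k) (hk' : k'' + 1 = k')
    (x : MC G ℓ k) : magBoundary G ℓ hk' (magBoundary G ℓ hk x) = 0 := by
  apply Subtype.ext
  change lengthPart G ℓ (boundary (lengthPart G ℓ (boundary (x : List V →₀ ℤ)))) = 0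
  rw [lengthPart_boundary_lengthPart G (boundary_lengthLE G (MC_le_lengthLE G ℓ k x.2)),
    boundary_boundary, map_zero]

theorem boundary_mem_of_mem_ker {ℓ ℓ' k k' : ℤ} (hℓ : ℓ' + 1 = ℓ) (hk : k' + 1 = k)
    {x : MC G ℓ k} (hx : magBoundary G ℓ hk x = 0) :
    boundary (x : List V →₀ ℤ) ∈ lengthLE G ℓ' := by
  have h1 : lengthPart G ℓ (boundary (x : List V →₀ ℤ)) = 0 := congrArg Subtype.val hx
  have h2 := sub_lengthPart_mem G hℓ (boundary_lengthLE G (MC_le_lengthLE G ℓ k x.2))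
  rwa [h1, sub_zero] at h2

/-- `∂'` maps cycles of the magnitude complex to cycles. -/
theorem partialBoundary_ker {ℓ ℓ' k k' k'' : ℤ} (hℓ : ℓ' + 1 = ℓ) (hk : k' + 1 = k)
    (hk' : k'' + 1 = k') (x : MC G ℓ k) (hx : magBoundary G ℓ hk x = 0) :
    magBoundary G ℓ' hk' (partialBoundary G ℓ ℓ' hk x) = 0 := by
  apply Subtype.ext
  change lengthPart G ℓ' (boundary (lengthPart G ℓ' (boundary (x : List V →₀ ℤ)))) = 0
  rw [lengthPart_boundary_lengthPart G (boundary_mem_of_mem_ker G hℓ hk hx),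
    boundary_boundary, map_zero]

/-- `∂'` maps boundaries of the magnitude complex to boundaries. -/
theorem partialBoundary_range {ℓ ℓ' k k' k'' : ℤ} (hℓ : ℓ' + 1 = ℓ) (hk : k' + 1 = k)
    (hk' : k'' + 1 = k') (y : MC G ℓ k) :
    partialBoundary G ℓ ℓ' hk' (magBoundary G ℓ hk y) =
      -magBoundary G ℓ' hk' (partialBoundary G ℓ ℓ' hk y) := by
  apply Subtype.ext
  change lengthPart G ℓ' (boundary (lengthPart G ℓ (boundary (y : List V →₀ ℤ)))) =
    -lengthPart G ℓ' (boundary (lengthPart G ℓ' (boundary (y : List V →₀ ℤ))))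
  set v := boundary (y : List V →₀ ℤ) with hv
  have hvv : boundary v = 0 := boundary_boundary _
  have hw := sub_lengthPart_mem G hℓ (boundary_lengthLE G (MC_le_lengthLE G ℓ k y.2))
  rw [← hv] at hw
  have h1 := lengthPart_boundary_lengthPart G hw
  have h2 : lengthPart G ℓ' (lengthPart G ℓ v) = 0 := by
    refine proj_eq_zero (fun x hx hx' => ?_) (proj_mem _ v)
    simp only [Set.mem_ofPred_eq] at hx hx'
    rw [hx, WithTop.coe_inj] at hx'
    omega
  rw [map_sub, h2, sub_zero, map_sub, hvv, zero_sub, map_neg] at h1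
  rw [h1, neg_neg]

/-- On cycles of the magnitude complex, `∂' ∘ ∂'` takes values in boundaries. -/
theorem partialBoundary_partialBoundary {ℓ ℓ' ℓ'' k k' k'' : ℤ} (hℓ : ℓ' + 1 = ℓ)
    (hℓ' : ℓ'' + 1 = ℓ') (hk : k' + 1 = k) (hk' : k'' + 1 = k') (x : MC G ℓ k)
    (hx : magBoundary G ℓ hk x = 0) :
    partialBoundary G ℓ' ℓ'' hk' (partialBoundary G ℓ ℓ' hk x) =
      -magBoundary G ℓ'' hk' (partialBoundary G ℓ ℓ'' hk x) := by
  apply Subtype.ext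
  change lengthPart G ℓ'' (boundary (lengthPart G ℓ' (boundary (x : List V →₀ ℤ)))) =
    -lengthPart G ℓ'' (boundary (lengthPart G ℓ'' (boundary (x : List V →₀ ℤ))))
  have hv' := boundary_mem_of_mem_ker G hℓ hk hx
  set v := boundary (x : List V →₀ ℤ) with hv
  have hvv : boundary v = 0 := boundary_boundary _
  have hw := sub_lengthPart_mem G hℓ' hv'
  have h1 := lengthPart_boundary_lengthPart G hw
  have h2 : lengthPart G ℓ'' (lengthPart G ℓ' v) = 0 := by
    refine proj_eq_zero (fun x hx hx' => ?_) (proj_mem _ v)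
    simp only [Set.mem_ofPred_eq] at hx hx'
    rw [hx, WithTop.coe_inj] at hx'
    omega
  rw [map_sub, h2, sub_zero, map_sub, hvv, zero_sub, map_neg] at h1
  rw [h1, neg_neg]

/-- For `ℓ' = ℓ - 1` and `k' = k - 1`, the differential `∂' : MH^ℓ_k(G) → MH^ℓ'_{k'}(G)`, induced
by `x ↦ (∂ x)^{ℓ-1}`. -/
noncomputable def magDifferential {ℓ ℓ' k k' : ℤ} (hℓ : ℓ' + 1 = ℓ) (hk : k' + 1 = k) :
    MH G ℓ k →ₗ[ℤ] MH G ℓ' k' :=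
  Submodule.mapQ _ _
    ((partialBoundary G ℓ ℓ' hk).restrict (p := LinearMap.ker (magBoundary G ℓ (sub_add_cancel k 1)))
      (q := LinearMap.ker (magBoundary G ℓ' (sub_add_cancel k' 1))) (by
        intro x hx
        obtain rfl : k' = k - 1 := by omega
        exact partialBoundary_ker G hℓ hk _ x hx))
    (by
      rintro ⟨x, hx⟩ ⟨y, hy⟩
      subst hk
      refine ⟨-partialBoundary G ℓ ℓ' rfl y, ?_⟩
      change magBoundary G ℓ' rfl _ = partialBoundary G ℓ ℓ' rfl x
      change magBoundary G ℓ rfl y = x at hy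
      rw [← hy, partialBoundary_range G hℓ rfl rfl y, map_neg])

theorem magDifferential_magDifferential {ℓ ℓ' ℓ'' k k' k'' : ℤ} (hℓ : ℓ' + 1 = ℓ)
    (hℓ' : ℓ'' + 1 = ℓ') (hk : k' + 1 = k) (hk' : k'' + 1 = k') (x : MH G ℓ k) :
    magDifferential G hℓ' hk' (magDifferential G hℓ hk x) = 0 := by
  obtain ⟨⟨x, hx⟩, rfl⟩ := Submodule.Quotient.mk_surjective _ x
  refine (Submodule.Quotient.mk_eq_zero _).mpr ?_
  subst hk' hk
  have hx' : magBoundary G ℓ (rfl : k'' + 1 + 1 = k'' + 1 + 1) x = 0 := by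
    apply Subtype.ext
    have h1 := LinearMap.mem_ker.mp hx
    have h2 := congrArg Subtype.val h1
    exact h2
  refine ⟨-partialBoundary G ℓ ℓ'' rfl x, ?_⟩
  change magBoundary G ℓ'' rfl _ = partialBoundary G ℓ' ℓ'' rfl (partialBoundary G ℓ ℓ' rfl x)
  rw [partialBoundary_partialBoundary G hℓ hℓ' rfl rfl x hx', map_neg]

/-- The homology `dMH^ℓ_k(G)` of the complex
`MH^{ℓ+1}_{k+1}(G) → MH^ℓ_k(G) → MH^{ℓ-1}_{k-1}(G)` with the differentials `∂'`. -/
abbrev dMH (ℓ k : ℤ) : Type _ :=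
  Homology (magDifferential G (rfl : ℓ + 1 = ℓ + 1) (rfl : k + 1 = k + 1))
    (magDifferential G (sub_add_cancel ℓ 1) (sub_add_cancel k 1))

end Magnitude

end PathMag

/-! Fix the length `ℓ` and suppose that a tuple `(x_0, …, x_k)` has `ℓ ≤ k + i`. Every step has
length at least 1, so two consecutive steps have total length at most `i + 2`. Girth at least `2 * i
+ 5` makes geodesics of length at most `i + 2` unique, and it prevents the two ends of an edge from
being equidistant from a vertex within distance `i + 1` of one of them. In this range the
differential of the magnitude complex, which removes an entry lying on a geodesic between its
neighbours, can be inverted by hand. Follow the tuple as long as it takes steps of length 1 and then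
turns back. At the first place where this fails, either a step is long and the first vertex of its
geodesic is inserted, or the tuple is already such an insertion and goes to zero. This is a
contracting homotopy on all tuples except the alternating ones `(x, y, x, y, …)` along an edge
(`diagonal_homotopy`), so cycles are homologous to combinations of alternating tuples
(`cycle_sub_mem`).

An alternating tuple with `k` steps has length `k`. Hence magnitude homology already vanishes at
`(ℓ, ℓ - j)` for `1 ≤ j ≤ i` (`MH_subsingleton`), and on the diagonal with `ℓ ≥ 1` it is the free
group on oriented edges (`exists_alternatingChain_eq`). All inner faces of an alternating tuple are
degenerate, so `∂'` becomes `σ ± 1` with alternating signs, where `σ` reverses edges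
(`boundary_alternating`). Since `σ` acts freely on oriented edges, this complex is exact for `ℓ ≥
2`. At `ℓ = 1` the outgoing map is the usual boundary from edges to vertices, while the image of `σ
+ 1` consists of symmetric chains; a cycle of the graph is closed but not symmetric. -/

namespace SimpleGraph

/-! ### Geodesics in graphs of large girth -/

variable {V : Type*} {g : SimpleGraph V}

/-- Two paths with the same ends whose lengths add up to less than the girth are equal. -/
theorem path_unique_of_lt_egirth {x y : V} {p q : g.Walk x y} (hp : p.IsPath) (hq : q.IsPath)
    (h : ((p.length + q.length : ℕ) : ℕ∞) < g.egirth) : p = q := by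
  classical
  -- The union of the two paths is a forest: a cycle in it has distinct edges among those of `p` and
  -- `q`, so it would be shorter than the girth. In a forest paths are unique.
  set s : Set (Sym2 V) := {e | e ∈ p.edges ∨ e ∈ q.edges} with hs
  set H := SimpleGraph.fromEdgeSet s with hH
  have hadj : ∀ e ∈ s, e ∈ H.edgeSet := by
    intro e he
    have hg : e ∈ g.edgeSet := he.elim (p.edges_subset_edgeSet ·) (q.edges_subset_edgeSet ·)
    rw [hH, SimpleGraph.edgeSet_fromEdgeSet]
    exact ⟨he, g.not_isDiag_of_mem_edgeSet hg⟩
  have hle : H ≤ g := by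
    intro a b hab
    rw [hH, SimpleGraph.fromEdgeSet_adj] at hab
    exact hab.1.elim (fun h => p.adj_of_mem_edges h) (fun h => q.adj_of_mem_edges h)
  have hac : H.IsAcyclic := by
    intro a c hc
    have h1 : c.edges.toFinset ⊆ (p.edges ++ q.edges).toFinset := by
      intro e he
      have h2 := c.edges_subset_edgeSet (List.mem_toFinset.mp he)
      rw [hH, SimpleGraph.edgeSet_fromEdgeSet] at h2
      simpa using (show e ∈ p.edges ∨ e ∈ q.edges from h2.1)
    have h2 := (Finset.card_le_card h1).trans (List.toFinset_card_le _)
    rw [List.toFinset_card_of_nodup hc.edges_nodup] at h2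
    simp only [List.length_append, SimpleGraph.Walk.length_edges] at h2
    have h3 : g.egirth ≤ (c.mapLe hle).length := SimpleGraph.egirth_le_length (hc.mapLe hle)
    rw [SimpleGraph.Walk.length_map] at h3
    exact absurd (h3.trans (Nat.cast_le.mpr h2)) (not_le.mpr h)
  have hpH : ∀ e ∈ p.edges, e ∈ H.edgeSet := fun e he => hadj e (Or.inl he)
  have hqH : ∀ e ∈ q.edges, e ∈ H.edgeSet := fun e he => hadj e (Or.inr he)
  have h1 := (hac.subsingleton_path x y).elim ⟨p.transfer H hpH, hp.transfer hpH⟩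
    ⟨q.transfer H hqH, hq.transfer hqH⟩
  have h2 := congrArg (fun r => r.1.support) h1
  simp only [SimpleGraph.Walk.support_transfer] at h2
  exact SimpleGraph.Walk.ext_support h2

/-- Geodesics shorter than half the girth are unique: their first step is determined. -/
theorem eq_of_adj_of_dist_add_one {n : ℕ} (hg : ((2 * n + 1 : ℕ) : ℕ∞) ≤ g.egirth) {x y v w : V}
    (hn : g.dist x y ≤ n) (hv : g.Adj x v) (hw : g.Adj x w) (hr : g.Reachable x y)
    (hdv : g.dist x y = g.dist v y + 1) (hdw : g.dist x y = g.dist w y + 1) : v = w := by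
  obtain ⟨p, hp⟩ := (hv.symm.reachable.trans hr).exists_walk_length_eq_dist
  obtain ⟨q, hq⟩ := (hw.symm.reachable.trans hr).exists_walk_length_eq_dist
  have h1 : (SimpleGraph.Walk.cons hv p).IsPath :=
    SimpleGraph.Walk.isPath_of_length_eq_dist _ (by simp [hp, hdv])
  have h2 : (SimpleGraph.Walk.cons hw q).IsPath :=
    SimpleGraph.Walk.isPath_of_length_eq_dist _ (by simp [hq, hdw])
  -- Both paths have length `g.dist x y ≤ n`, in total less than `2 * n + 1`.
  have h3 := path_unique_of_lt_egirth h1 h2 (lt_of_lt_of_le (Nat.cast_lt.mpr (by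
    simp only [SimpleGraph.Walk.length_cons]; omega)) hg)
  have h4 := congrArg SimpleGraph.Walk.snd h3
  simpa using h4

/-- There are no odd closed walks around an edge shorter than the girth: the ends of an edge have
different distances to every near vertex. -/
theorem dist_ne_of_adj {n : ℕ} (hg : ((2 * n + 2 : ℕ) : ℕ∞) ≤ g.egirth) {x v z : V}
    (hv : g.Adj x v) (hr : g.Reachable x z) (hn : g.dist x z ≤ n) : g.dist x z ≠ g.dist v z := by
  classical
  intro h
  obtain ⟨p, hpp, hp⟩ := hr.exists_path_of_dist
  obtain ⟨q, hqq, hq⟩ := (hv.symm.reachable.trans hr).exists_path_of_dist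
  -- If the geodesic `q` from `v` passes through `x`, its tail from `x` is too short. Otherwise `p`
  -- and `q` extended by the edge are two paths from `x` to `z` of different lengths and total
  -- length at most `2 * n + 1`.
  by_cases hx : x ∈ q.support
  · have h1 := SimpleGraph.dist_le (q.dropUntil x hx)
    have h2 := congrArg SimpleGraph.Walk.length (q.take_spec hx)
    rw [SimpleGraph.Walk.length_append] at h2
    have h3 : (q.takeUntil x hx).length ≠ 0 := fun h0 =>
      hv.ne' (SimpleGraph.Walk.eq_of_length_eq_zero h0)
    omega
  · have h1 : (SimpleGraph.Walk.cons hv q).IsPath := hqq.cons hx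
    have h3 := path_unique_of_lt_egirth hpp h1 (lt_of_lt_of_le (Nat.cast_lt.mpr (by
      simp only [SimpleGraph.Walk.length_cons]; omega)) hg)
    have h4 := congrArg SimpleGraph.Walk.length h3
    simp only [SimpleGraph.Walk.length_cons] at h4
    omega

theorem Reachable.exists_adj_dist {x y : V} (h : g.Reachable x y) (hne : x ≠ y) :
    ∃ v, g.Adj x v ∧ g.dist x y = g.dist v y + 1 := by
  obtain ⟨p, hp⟩ := h.exists_walk_length_eq_dist
  cases p with
  | nil => exact absurd rfl hne
  | cons hv q =>
    rename_i v
    refine ⟨v, hv, ?_⟩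
    have h1 := SimpleGraph.dist_le q
    have h2 := SimpleGraph.Reachable.dist_triangle_left hv.reachable y
    rw [SimpleGraph.dist_eq_one_iff_adj.mpr hv] at h2
    simp only [SimpleGraph.Walk.length_cons] at hp
    omega

end SimpleGraph

/-! ### The insertion homotopy -/

namespace PathMag

variable {V : Type*}

theorem consMap_single (x : V) (l : List V) (c : ℤ) :
    consMap x (Finsupp.single l c) = Finsupp.single (x :: l) c := by
  simp [consMap, Finsupp.mapDomain_single]

theorem linearMap_ext_single {M : Type*} [AddCommGroup M] {f f' : (List V →₀ ℤ) →ₗ[ℤ] M}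
    (h : ∀ x, f (Finsupp.single x 1) = f' (Finsupp.single x 1)) : f = f' :=
  Finsupp.lhom_ext' fun l => LinearMap.ext_ring (h l)

variable (g : SimpleGraph V)

/-- The tuples whose consecutive entries are distinct and lie in the same component. -/
def reachableTuples : Set (List V) := {x | x.IsChain (fun a b => g.Reachable a b ∧ a ≠ b)}

/-- The sum of the distances between consecutive entries. -/
noncomputable def distLength : List V → ℕ
  | [] => 0
  | [_] => 0
  | x :: y :: l => g.dist x y + distLength (y :: l)

open Classical in
/-- The part of the boundary of a tuple that preserves the length. -/
noncomputable def diagonalFaces : List V → (List V →₀ ℤ)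
  | [] => 0
  | [_] => 0
  | [_, _] => 0
  | x :: y :: z :: l =>
    -(if g.dist x z = g.dist x y + g.dist y z then Finsupp.single (x :: z :: l) 1 else 0) -
      consMap x (diagonalFaces (y :: z :: l))

/-- The linear extension of `diagonalFaces`. -/
noncomputable def diagonalBoundary : (List V →₀ ℤ) →ₗ[ℤ] (List V →₀ ℤ) :=
  Finsupp.linearCombination ℤ (diagonalFaces g)

open Classical in
/-- The first vertex after `x` on a geodesic from `x` to `y`. -/
noncomputable def nextVertex (x y : V) : V :=
  if h : ∃ v, g.Adj x v ∧ g.dist x y = g.dist v y + 1 then h.choose else x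

open Classical in
/-- Insertion of a vertex at the first place where the walk that a tuple runs through does not
backtrack, provided that the vertex at this place is missing. -/
noncomputable def insertion : List V → (List V →₀ ℤ)
  | [] => 0
  | [_] => 0
  | [x, y] => if 2 ≤ g.dist x y then -Finsupp.single [x, nextVertex g x y, y] 1 else 0
  | x :: y :: z :: l =>
    if 2 ≤ g.dist x y then -Finsupp.single (x :: nextVertex g x y :: y :: z :: l) 1
    else if g.dist y z = g.dist x z + 1 then -consMap x (insertion (y :: z :: l)) else 0

/-- The linear extension of `insertion`. -/
noncomputable def insertionMap : (List V →₀ ℤ) →ₗ[ℤ] (List V →₀ ℤ) :=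
  Finsupp.linearCombination ℤ (insertion g)

/-- The tuple `(x, y, x, y, …)` with `n + 1` entries. -/
def alternating : ℕ → V → V → List V
  | 0, x, _ => [x]
  | n + 1, x, y => x :: alternating n y x

/-- The tuples `(x, y, x, y, …)` that run back and forth along an edge. -/
def alternatingTuples : Set (List V) := {w | ∃ n x y, g.Adj x y ∧ w = alternating n x y}

variable {g}

theorem nextVertex_spec {x y : V} (h : g.Reachable x y) (hne : x ≠ y) :
    g.Adj x (nextVertex g x y) ∧ g.dist x y = g.dist (nextVertex g x y) y + 1 := by
  have h1 := h.exists_adj_dist hne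
  rw [nextVertex, dif_pos h1]
  exact h1.choose_spec

theorem diagonalBoundary_single (x : List V) :
    diagonalBoundary g (Finsupp.single x 1) = diagonalFaces g x := by
  simp [diagonalBoundary]

theorem insertionMap_single (x : List V) :
    insertionMap g (Finsupp.single x 1) = insertion g x := by
  simp [insertionMap]

/-- Length-preserving faces keep the first entry. This exposes the leading vertices of a whole
chain, as the `consMap` formulas for `diagonalBoundary` and `insertionMap` require. -/
theorem exists_diagonalFaces_eq (x : V) (l : List V) :
    ∃ u, diagonalFaces g (x :: l) = consMap x u := by
  classical
  match l with
  | [] => exact ⟨0, by simp [diagonalFaces]⟩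
  | [y] => exact ⟨0, by simp [diagonalFaces]⟩
  | y :: z :: l =>
    refine ⟨-(if g.dist x z = g.dist x y + g.dist y z then Finsupp.single (z :: l) 1 else 0) -
      diagonalFaces g (y :: z :: l), ?_⟩
    rw [diagonalFaces, map_sub, map_neg]
    split_ifs <;> simp [consMap_single]

theorem exists_insertion_eq (x : V) (l : List V) :
    ∃ u, insertion g (x :: l) = consMap x u := by
  classical
  match l with
  | [] => exact ⟨0, by simp [insertion]⟩
  | [y] =>
    rw [insertion]
    split_ifs
    · exact ⟨-Finsupp.single [nextVertex g x y, y] 1, by simp [consMap_single]⟩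
    · exact ⟨0, by simp⟩
  | y :: z :: l =>
    rw [insertion]
    split_ifs
    · exact ⟨-Finsupp.single (nextVertex g x y :: y :: z :: l) 1, by simp [consMap_single]⟩
    · exact ⟨-insertion g (y :: z :: l), by simp⟩
    · exact ⟨0, by simp⟩

open Classical in
theorem diagonalBoundary_cons (x y z : V) (u : List V →₀ ℤ) :
    diagonalBoundary g (consMap x (consMap y (consMap z u))) =
      -(if g.dist x z = g.dist x y + g.dist y z then consMap x (consMap z u) else 0) -
        consMap x (diagonalBoundary g (consMap y (consMap z u))) := by
  split_ifs with h
  · refine LinearMap.congr_fun (f := diagonalBoundary g ∘ₗ consMap x ∘ₗ consMap y ∘ₗ consMap z)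
      (g := -(consMap x ∘ₗ consMap z) - consMap x ∘ₗ diagonalBoundary g ∘ₗ consMap y ∘ₗ consMap z)
      (linearMap_ext_single fun l => ?_) u
    simp [consMap_single, diagonalBoundary_single, diagonalFaces, h]
  · rw [neg_zero, zero_sub]
    refine LinearMap.congr_fun (f := diagonalBoundary g ∘ₗ consMap x ∘ₗ consMap y ∘ₗ consMap z)
      (g := -(consMap x ∘ₗ diagonalBoundary g ∘ₗ consMap y ∘ₗ consMap z))
      (linearMap_ext_single fun l => ?_) u
    simp [consMap_single, diagonalBoundary_single, diagonalFaces, h]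

theorem insertionMap_of_two_le {x y : V} (h : 2 ≤ g.dist x y) (u : List V →₀ ℤ) :
    insertionMap g (consMap x (consMap y u)) =
      -consMap x (consMap (nextVertex g x y) (consMap y u)) := by
  refine LinearMap.congr_fun (f := insertionMap g ∘ₗ consMap x ∘ₗ consMap y)
    (g := -(consMap x ∘ₗ consMap (nextVertex g x y) ∘ₗ consMap y))
    (linearMap_ext_single fun l => ?_) u
  cases l <;> simp [consMap_single, insertionMap_single, insertion, h]

theorem insertionMap_of_backtrack {x y z : V} (h : ¬2 ≤ g.dist x y)
    (h' : g.dist y z = g.dist x z + 1) (u : List V →₀ ℤ) :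
    insertionMap g (consMap x (consMap y (consMap z u))) =
      -consMap x (insertionMap g (consMap y (consMap z u))) := by
  refine LinearMap.congr_fun (f := insertionMap g ∘ₗ consMap x ∘ₗ consMap y ∘ₗ consMap z)
    (g := -(consMap x ∘ₗ insertionMap g ∘ₗ consMap y ∘ₗ consMap z))
    (linearMap_ext_single fun l => ?_) u
  simp only [LinearMap.comp_apply, LinearMap.neg_apply, consMap_single, insertionMap_single]
  rw [insertion, if_neg h, if_pos h']

theorem insertionMap_of_not_backtrack {x y z : V} (h : ¬2 ≤ g.dist x y)
    (h' : ¬g.dist y z = g.dist x z + 1) (u : List V →₀ ℤ) :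
    insertionMap g (consMap x (consMap y (consMap z u))) = 0 := by
  refine LinearMap.congr_fun (f := insertionMap g ∘ₗ consMap x ∘ₗ consMap y ∘ₗ consMap z)
    (g := 0) (linearMap_ext_single fun l => ?_) u
  simp only [LinearMap.comp_apply, LinearMap.zero_apply, consMap_single, insertionMap_single]
  rw [insertion, if_neg h, if_neg h']

theorem length_le_distLength : ∀ {x : List V}, x ∈ reachableTuples g →
    x.length ≤ distLength g x + 1
  | [], _ => by simp
  | [x], _ => by simp
  | x :: y :: l, h => by
    have h1 := List.isChain_cons_cons.mp h
    have h2 := length_le_distLength (x := y :: l) h1.2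
    have h3 := h1.1.1.pos_dist_of_ne h1.1.2
    simp only [List.length_cons, distLength] at *
    omega

/-- Up to alternating tuples, `insertionMap` is a contracting homotopy in the range where
geodesics are unique. -/
theorem diagonal_homotopy {i : ℕ} (hg : ((2 * i + 5 : ℕ) : ℕ∞) ≤ g.egirth) :
    ∀ (l : List V) (x y : V), x :: y :: l ∈ reachableTuples g →
      distLength g (x :: y :: l) ≤ l.length + 1 + i → x :: y :: l ∉ alternatingTuples g →
      diagonalBoundary g (insertion g (x :: y :: l)) +
        insertionMap g (diagonalFaces g (x :: y :: l)) = Finsupp.single (x :: y :: l) 1 := by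
  classical
  -- The constant is sharp here, `2 * (i + 2) + 1 = 2 * i + 5`; the parity statement `hO` needs only
  -- `2 * (i + 1) + 2`.
  have hU : ∀ {x y v w : V}, g.dist x y ≤ i + 2 → g.Adj x v → g.Adj x w → g.Reachable x y →
      g.dist x y = g.dist v y + 1 → g.dist x y = g.dist w y + 1 → v = w := fun hn hv hw hr =>
    SimpleGraph.eq_of_adj_of_dist_add_one (n := i + 2) hg hn hv hw hr
  have hO : ∀ {x v z : V}, g.Adj x v → g.Reachable x z → g.dist x z ≤ i + 1 →
      g.dist x z ≠ g.dist v z := fun hv hr hn =>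
    SimpleGraph.dist_ne_of_adj (n := i + 1) (le_trans (Nat.cast_le.mpr (by omega)) hg) hv hr hn
  have htri : ∀ {a b : V} (c : V), g.Reachable a b →
      g.dist a c ≤ g.dist a b + g.dist b c := fun c h => h.dist_triangle_left c
  have hadj1 : ∀ {a b : V}, g.Adj a b → g.dist a b = 1 := fun h =>
    SimpleGraph.dist_eq_one_iff_adj.mpr h
  intro l
  induction l with
  | nil =>
    intro x y hx hl ha
    have h1 := (List.isChain_cons_cons.mp hx).1
    have hpos := h1.1.pos_dist_of_ne h1.2
    have hd : 2 ≤ g.dist x y := by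
      by_contra hd
      exact ha ⟨1, x, y, SimpleGraph.dist_eq_one_iff_adj.mp (by omega), rfl⟩
    obtain ⟨hv, hv'⟩ := nextVertex_spec h1.1 h1.2
    set v := nextVertex g x y with hvdef
    have hgeo : g.dist x y = g.dist x v + g.dist v y := by rw [hadj1 hv]; omega
    rw [insertion, if_pos hd, ← hvdef, map_neg, diagonalBoundary_single, diagonalFaces,
      diagonalFaces, if_pos hgeo]
    simp [diagonalFaces]
  | cons z l ih =>
    intro x y hx hl ha
    obtain ⟨⟨hrxy, hxy⟩, hx'⟩ := List.isChain_cons_cons.mp hx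
    obtain ⟨⟨hryz, hyz⟩, hx''⟩ := List.isChain_cons_cons.mp hx'
    have hxypos := hrxy.pos_dist_of_ne hxy
    have hyzpos := hryz.pos_dist_of_ne hyz
    have hlen := length_le_distLength (g := g) (x := z :: l) hx''
    simp only [distLength, List.length_cons] at hl hlen
    -- The other `l.length` steps have length at least 1 each, so the first two carry at most the
    -- whole excess `i`.
    have hsum : g.dist x y + g.dist y z ≤ i + 2 := by omega
    have hrxz := hrxy.trans hryz
    have txz := htri z hrxy
    have tyz := htri z hrxy.symm
    rw [g.dist_comm (u := y) (v := x)] at tyz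
    by_cases hd : 2 ≤ g.dist x y
    · obtain ⟨hv, hv'⟩ := nextVertex_spec hrxy hxy
      have hgeo : g.dist x y = g.dist x (nextVertex g x y) + g.dist (nextVertex g x y) y := by
        rw [hadj1 hv]; omega
      have hrvy := hv.symm.reachable.trans hrxy
      have tv := htri z hrvy
      have tx := htri z hv.reachable
      rw [hadj1 hv] at tx
      -- The entry `y` can be removed after `x` exactly when it can be removed after the inserted
      -- vertex, so these two faces cancel between `∂h` and `h∂`.
      have hiff : g.dist x z = g.dist x y + g.dist y z ↔
          g.dist (nextVertex g x y) z = g.dist (nextVertex g x y) y + g.dist y z := by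
        constructor
        · intro h; omega
        · intro h
          have tv' := htri z hv.symm.reachable
          rw [hadj1 hv.symm] at tv'
          have h1 := hO hv hrxz
          by_contra hne
          have h2 : g.dist (nextVertex g x y) z = g.dist x z + 1 := by
            by_cases hle : g.dist x z ≤ i + 1
            · have := h1 hle; omega
            · omega
          have hvy : nextVertex g x y ≠ y := by
            intro h0
            rw [h0] at hv
            rw [hadj1 hv] at hd
            omega
          obtain ⟨hw, hw'⟩ := nextVertex_spec hrvy hvy
          set v := nextVertex g x y
          set w := nextVertex g v y
          have hrwy := hw.symm.reachable.trans hrvy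
          have t3 := htri z hrwy
          have t4 := htri z hw.reachable
          rw [hadj1 hw] at t4
          -- Both `w` and `x` start a geodesic from `v` to `z`. But `w` is closer to `y` than `v`
          -- is, and `x` is farther away.
          have h5 : w = x := hU (by omega) hw hv.symm (hrvy.trans hryz) (by omega) h2
          rw [h5] at hw'
          omega
      rw [insertion, if_pos hd, map_neg, diagonalBoundary_single, diagonalFaces, if_pos hgeo,
        diagonalFaces, diagonalFaces]
      obtain ⟨u, hu⟩ := exists_diagonalFaces_eq (g := g) y (z :: l)
      rw [hu]
      simp only [map_sub, map_neg, insertionMap_of_two_le hd]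
      by_cases hz : g.dist x z = g.dist x y + g.dist y z
      · rw [if_pos hz, if_pos (hiff.mp hz), insertionMap_single]
        -- The geodesic from `x` to `z` runs through `y`, so both have the same first vertex.
        have hvz : nextVertex g x z = nextVertex g x y := by
          have hxz : x ≠ z := by
            rintro rfl
            simp at hz
            omega
          obtain ⟨hw, hw'⟩ := nextVertex_spec hrxz hxz
          have := hiff.mp hz
          exact hU (by omega) hw hv hrxz hw' (by omega)
        have : insertion g (x :: z :: l) = -Finsupp.single (x :: nextVertex g x z :: z :: l) 1 := by
          cases l <;> rw [insertion, if_pos (by omega)]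
        rw [this, hvz, consMap_single]
        abel
      · rw [if_neg hz, if_neg (fun h => hz (hiff.mpr h))]
        simp
    · have hd1 : g.dist x y = 1 := by omega
      have hadj := SimpleGraph.dist_eq_one_iff_adj.mp hd1
      by_cases hb : g.dist y z = g.dist x z + 1
      · have hngeo : ¬g.dist x z = g.dist x y + g.dist y z := by omega
        -- Here the tuple turns back at `y`. If the tail were alternating, then `g.dist y z = 1`
        -- would force `x = z`, and the whole tuple would be alternating.
        have hih := ih y z hx' (by simp only [distLength]; omega) (by
          rintro ⟨n, a, b, hab, he⟩
          cases n with
          | zero => simp [alternating] at he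
          | succ n =>
            have hz : y = a ∧ z = b := by
              cases n <;> simp [alternating] at he <;> exact ⟨he.1, he.2.1⟩
            obtain ⟨rfl, rfl⟩ := hz
            have hxz : x = z := by
              have := hadj1 hab
              exact hrxz.dist_eq_zero_iff.mp (by omega)
            subst hxz
            exact ha ⟨n + 2, x, y, hadj, by rw [he]; rfl⟩)
        have hA : diagonalBoundary g (insertion g (x :: y :: z :: l)) =
            consMap x (diagonalBoundary g (insertion g (y :: z :: l))) := by
          rw [insertion, if_neg hd, if_pos hb, map_neg]
          -- After the insertion the entry following `y` is `x` itself or still `z`; in neither case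
          -- does `y` lie on a geodesic from `x` to it, so no face removes `y`.
          have key : ∃ w u, insertion g (y :: z :: l) = consMap y (consMap w u) ∧
              ¬g.dist x w = g.dist x y + g.dist y w := by
            by_cases hd2 : 2 ≤ g.dist y z
            · refine ⟨nextVertex g y z, -Finsupp.single (z :: l) 1, ?_, ?_⟩
              · cases l <;> rw [insertion, if_pos hd2] <;> simp [consMap_single]
              · obtain ⟨hw, hw'⟩ := nextVertex_spec hryz hyz
                have : nextVertex g y z = x := hU (by omega) hw hadj.symm hryz hw' hb
                rw [this]
                simp
                omega
            · refine ⟨z, ?_⟩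
              match l with
              | [] => exact ⟨0, by rw [insertion, if_neg hd2]; simp, hngeo⟩
              | z' :: l =>
                rw [insertion, if_neg hd2]
                split_ifs
                · obtain ⟨u, hu⟩ := exists_insertion_eq (g := g) z (z' :: l)
                  exact ⟨-u, by simp [hu], hngeo⟩
                · exact ⟨0, by simp, hngeo⟩
          obtain ⟨w, u, hu, hw⟩ := key
          rw [hu, diagonalBoundary_cons, if_neg hw]
          simp
        have hB : insertionMap g (diagonalFaces g (x :: y :: z :: l)) =
            consMap x (insertionMap g (diagonalFaces g (y :: z :: l))) := by
          rw [diagonalFaces, if_neg hngeo, neg_zero, zero_sub, map_neg]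
          match l with
          | [] => simp [diagonalFaces]
          | z' :: l =>
            obtain ⟨u, hu⟩ := exists_diagonalFaces_eq (g := g) z (z' :: l)
            rw [diagonalFaces, hu]
            split_ifs with hz'
            · have hb' : g.dist y z' = g.dist x z' + 1 := by
                have h1 := htri z' hrxz
                have h2 := htri z' hrxy.symm
                rw [hadj1 hadj.symm] at h2
                omega
              rw [← consMap_single, ← consMap_single]
              simp only [map_sub, map_neg, insertionMap_of_backtrack hd hb,
                insertionMap_of_backtrack hd hb']
              abel
            · simp only [map_sub, map_neg, map_zero, insertionMap_of_backtrack hd hb]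
              abel
        rw [hA, hB, ← map_add, hih, consMap_single]
      · have hgeo : g.dist x z = g.dist x y + g.dist y z := by
          have := hO hadj.symm hryz (by omega)
          omega
        rw [insertion, if_neg hd, if_neg hb, map_zero, zero_add, diagonalFaces, if_pos hgeo,
          map_sub, map_neg, insertionMap_single]
        have hA : insertion g (x :: z :: l) = -Finsupp.single (x :: y :: z :: l) 1 := by
          have hxz : x ≠ z := by
            rintro rfl
            simp at hgeo
            omega
          obtain ⟨hw, hw'⟩ := nextVertex_spec hrxz hxz
          have : nextVertex g x z = y := hU (by omega) hw hadj hrxz hw' (by omega)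
          cases l <;> rw [insertion, if_pos (by omega), this]
        have hB : insertionMap g (consMap x (diagonalFaces g (y :: z :: l))) = 0 := by
          match l with
          | [] => simp [diagonalFaces]
          | z' :: l =>
            obtain ⟨u, hu⟩ := exists_diagonalFaces_eq (g := g) z (z' :: l)
            rw [diagonalFaces, hu]
            split_ifs with hz'
            · have hb' : ¬g.dist y z' = g.dist x z' + 1 := by
                intro hb'
                obtain ⟨⟨hrzz', hzz'⟩, hx3⟩ := List.isChain_cons_cons.mp hx''
                have hlen' := length_le_distLength (g := g) (x := z' :: l) hx3
                simp only [distLength, List.length_cons] at hl hlen'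
                obtain ⟨hw, hw'⟩ := nextVertex_spec hryz hyz
                have hrwz := hw.symm.reachable.trans hryz
                have t1 := htri z' hrwz
                have t2 := htri z' hw.reachable
                rw [hadj1 hw] at t2
                have : nextVertex g y z = x :=
                  hU (by omega) hw hadj.symm (hryz.trans hrzz') (by omega) hb'
                rw [this] at hw'
                exact hb hw'
              rw [← consMap_single, ← consMap_single]
              simp only [map_sub, map_neg, insertionMap_of_not_backtrack hd hb,
                insertionMap_of_not_backtrack hd hb']
              simp
            · simp only [map_sub, map_neg, map_zero, insertionMap_of_not_backtrack hd hb]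
              simp
        rw [hA, hB]
        simp

/-! ### The magnitude complex of the symmetric digraph -/

theorem pathDist_symmDigraph (x y : V) : pathDist g.symmDigraph x y = g.edist x y := by
  apply le_antisymm
  · by_cases h : g.Reachable x y
    · obtain ⟨p, hp⟩ := h.exists_walk_length_eq_edist
      rw [← hp]
      exact iInf₂_le p.length ⟨p.getVert, by simp, by simp, fun i hi => p.adj_getVert_succ hi⟩
    · rw [SimpleGraph.edist_eq_top_of_not_reachable h]
      exact le_top
  · refine le_iInf₂ ?_
    rintro n ⟨p, rfl, rfl, hp⟩
    have key : ∀ m ≤ n, g.edist (p 0) (p m) ≤ m := by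
      intro m
      induction m with
      | zero => simp
      | succ m ih =>
        intro hm
        have h1 : g.Adj (p m) (p (m + 1)) := hp m (by omega)
        have h2 := g.edist_triangle (u := p 0) (v := p m) (w := p (m + 1))
        rw [SimpleGraph.edist_eq_one_iff_adj.mpr h1] at h2
        push_cast
        exact h2.trans (add_le_add (ih (by omega)) le_rfl)
    exact key n le_rfl

theorem map_pathDist {x y : V} (h : g.Reachable x y) :
    ENat.map (fun n : ℕ => (n : ℤ)) (pathDist g.symmDigraph x y) = ((g.dist x y : ℤ) : WithTop ℤ) := by
  rw [pathDist_symmDigraph, ← h.coe_dist_eq_edist]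
  rfl

theorem tupleLength_eq : ∀ {x : List V}, x ≠ [] → x ∈ reachableTuples g →
    tupleLength g.symmDigraph x = ((distLength g x : ℤ) : WithTop ℤ)
  | [], h, _ => absurd rfl h
  | [x], _, _ => rfl
  | x :: y :: l, _, h => by
    have h1 := List.isChain_cons_cons.mp h
    rw [tupleLength, map_pathDist h1.1.1, tupleLength_eq (List.cons_ne_nil y l) h1.2, distLength,
      Nat.cast_add, WithTop.coe_add]

theorem mem_reachableTuples : ∀ {x : List V}, x ∈ regularTuples V →
    tupleLength g.symmDigraph x ≠ ⊤ → x ∈ reachableTuples g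
  | [], _, _ => List.IsChain.nil
  | [x], _, _ => List.IsChain.singleton x
  | x :: y :: l, h, h' => by
    have h1 := List.isChain_cons_cons.mp h
    rw [tupleLength, Ne, WithTop.add_eq_top, not_or] at h'
    have hr : g.Reachable x y := by
      by_contra hr
      apply h'.1
      rw [pathDist_symmDigraph, SimpleGraph.edist_eq_top_of_not_reachable hr]
      rfl
    exact List.isChain_cons_cons.mpr ⟨⟨hr, h1.1⟩, mem_reachableTuples h1.2 h'.2⟩

theorem reachableTuples_subset : reachableTuples g ⊆ regularTuples V := fun _ h =>
  List.IsChain.imp (fun _ _ h => h.2) h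

/-- For positive length the magnitude chains of a graph are spanned by the tuples of given sum of
distances. -/
theorem MC_symmDigraph {ℓ k : ℤ} (hℓ : 0 ≤ ℓ) : MC g.symmDigraph ℓ k =
    Finsupp.supported ℤ ℤ {x : List V | (x.length : ℤ) = k + 1 ∧ x ≠ [] ∧ x ∈ reachableTuples g ∧
      (distLength g x : ℤ) = ℓ} := by
  rw [MC]
  congr 1
  ext x
  constructor
  · rintro ⟨h1, h2, h3⟩
    have hne : x ≠ [] := by
      rintro rfl
      have : ((-1 : ℤ) : WithTop ℤ) = (ℓ : WithTop ℤ) := h3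
      rw [WithTop.coe_inj] at this
      omega
    have h4 := mem_reachableTuples (g := g) h2 (by rw [h3]; exact WithTop.coe_ne_top)
    rw [tupleLength_eq hne h4, WithTop.coe_inj] at h3
    exact ⟨h1, hne, h4, h3⟩
  · rintro ⟨h1, h2, h3, h4⟩
    refine ⟨h1, reachableTuples_subset h3, ?_⟩
    rw [tupleLength_eq h2 h3, h4]

open Classical in
theorem lengthPart_proj_single (n : ℤ) (x : List V) :
    lengthPart g.symmDigraph n (proj (regularTuples V) (Finsupp.single x 1)) =
      if x ∈ regularTuples V ∧ tupleLength g.symmDigraph x = (n : WithTop ℤ)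
        then Finsupp.single x 1 else 0 := by
  by_cases h : x ∈ regularTuples V
  · rw [proj_single_mem h, lengthPart]
    by_cases h' : tupleLength g.symmDigraph x = (n : WithTop ℤ)
    · rw [proj_single_mem h', if_pos ⟨h, h'⟩]
    · rw [proj_single_notMem h', if_neg (fun h0 => h' h0.2)]
  · rw [proj_single_notMem h, map_zero, if_neg (fun h0 => h h0.1)]

theorem lengthPart_proj_cons {x y : V} (hr : g.Reachable x y) (hne : x ≠ y) (n : ℤ)
    (u : List V →₀ ℤ) :
    lengthPart g.symmDigraph (g.dist x y + n) (proj (regularTuples V) (consMap x (consMap y u))) =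
      consMap x (lengthPart g.symmDigraph n (proj (regularTuples V) (consMap y u))) := by
  classical
  refine LinearMap.congr_fun
    (f := lengthPart g.symmDigraph (g.dist x y + n) ∘ₗ proj (regularTuples V) ∘ₗ consMap x ∘ₗ
      consMap y)
    (g := consMap x ∘ₗ lengthPart g.symmDigraph n ∘ₗ proj (regularTuples V) ∘ₗ consMap y)
    (linearMap_ext_single fun l => ?_) u
  simp only [LinearMap.comp_apply, consMap_single, lengthPart_proj_single]
  have h1 : x :: y :: l ∈ regularTuples V ↔ y :: l ∈ regularTuples V :=
    List.isChain_cons_cons.trans (and_iff_right hne)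
  have h2 : tupleLength g.symmDigraph (x :: y :: l) = ((g.dist x y + n : ℤ) : WithTop ℤ) ↔
      tupleLength g.symmDigraph (y :: l) = (n : WithTop ℤ) := by
    rw [tupleLength, map_pathDist hr, WithTop.coe_add]
    exact WithTop.add_left_inj WithTop.coe_ne_top
  simp only [h1, h2]
  split_ifs <;> simp [consMap_single]

/-- Removing the first or last entry loses a step of positive length, so only the inner faces at
geodesic entries keep the length. -/
theorem lengthPart_boundary_single : ∀ {x : List V}, x ≠ [] → x ∈ reachableTuples g →
    lengthPart g.symmDigraph (distLength g x) (boundary (Finsupp.single x 1)) = diagonalFaces g x := by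
  classical
  suffices H : ∀ x : List V, x ≠ [] → x ∈ reachableTuples g →
      lengthPart g.symmDigraph (distLength g x)
        (proj (regularTuples V) (preBoundary (Finsupp.single x 1))) = diagonalFaces g x from
    fun {x} => H x
  intro x
  induction x with
  | nil => exact fun h => absurd rfl h
  | cons x l ih =>
    intro _ hx
    match l with
    | [] =>
      -- The face of a single vertex is the empty tuple. Its length is `-1` and not `0`, so it does
      -- not count.
      rw [preBoundary_cons_single, preBoundary_nil, map_zero, sub_zero, lengthPart_proj_single,
        if_neg]
      · rfl
      · rintro ⟨-, h⟩
        have : ((-1 : ℤ) : WithTop ℤ) = ((0 : ℕ) : ℤ) := h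
        rw [WithTop.coe_inj] at this
        omega
    | y :: m =>
      obtain ⟨⟨hr, hne⟩, hx'⟩ := List.isChain_cons_cons.mp hx
      have hpos := hr.pos_dist_of_ne hne
      have ih' := ih (List.cons_ne_nil y m) hx'
      have hz : lengthPart g.symmDigraph (distLength g (x :: y :: m))
          (proj (regularTuples V) (Finsupp.single (y :: m) 1)) = 0 := by
        rw [lengthPart_proj_single, if_neg]
        rintro ⟨-, h⟩
        rw [tupleLength_eq (List.cons_ne_nil y m) hx', WithTop.coe_inj, distLength] at h
        omega
      have hz' : lengthPart g.symmDigraph (distLength g (y :: m))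
          (proj (regularTuples V) (Finsupp.single m 1)) = 0 := by
        rw [lengthPart_proj_single, if_neg]
        rintro ⟨-, h⟩
        match m with
        | [] =>
          have : ((-1 : ℤ) : WithTop ℤ) = ((0 : ℕ) : ℤ) := h
          rw [WithTop.coe_inj] at this
          omega
        | z :: m =>
          obtain ⟨⟨hr', hne'⟩, hx''⟩ := List.isChain_cons_cons.mp hx'
          have := hr'.pos_dist_of_ne hne'
          rw [tupleLength_eq (List.cons_ne_nil z m) hx'', WithTop.coe_inj, distLength] at h
          omega
      rw [preBoundary_cons_single, map_sub, map_sub, hz', zero_sub] at ih'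
      have hlast : lengthPart g.symmDigraph (distLength g (x :: y :: m)) (proj (regularTuples V)
          (consMap x (consMap y (preBoundary (Finsupp.single m 1))))) =
          -consMap x (diagonalFaces g (y :: m)) := by
        rw [distLength, Nat.cast_add, lengthPart_proj_cons hr hne, ← ih', map_neg, neg_neg]
      rw [preBoundary_cons_single, preBoundary_cons_single]
      simp only [map_sub, hz, hlast, consMap_single, lengthPart_proj_single]
      match m with
      | [] =>
        rw [if_neg]
        · simp [diagonalFaces]
        · rintro ⟨-, h⟩
          have : ((0 : ℤ) : WithTop ℤ) = ((distLength g [x, y] : ℕ) : ℤ) := h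
          rw [WithTop.coe_inj, distLength] at this
          omega
      | z :: m =>
        obtain ⟨⟨hr', hne'⟩, hx''⟩ := List.isChain_cons_cons.mp hx'
        have hpos' := hr'.pos_dist_of_ne hne'
        have hiff : (x :: z :: m ∈ regularTuples V ∧ tupleLength g.symmDigraph (x :: z :: m) =
            ((distLength g (x :: y :: z :: m) : ℤ) : WithTop ℤ)) ↔
            g.dist x z = g.dist x y + g.dist y z := by
          rw [tupleLength, map_pathDist (hr.trans hr'),
            tupleLength_eq (List.cons_ne_nil z m) hx'', ← WithTop.coe_add, WithTop.coe_inj,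
            distLength, distLength]
          constructor
          · rintro ⟨-, h⟩
            omega
          · intro h
            refine ⟨List.isChain_cons_cons.mpr ⟨?_, reachableTuples_subset hx''⟩, by omega⟩
            -- A degenerate face `x = z` would need `0 = g.dist x y + g.dist y z`, so the geodesic
            -- condition already implies regularity.
            rintro rfl
            simp at h
            omega
        rw [diagonalFaces]
        simp only [hiff]
        abel

theorem lengthPart_boundary_eq {ℓ k : ℤ} (hℓ : 0 ≤ ℓ) {u : List V →₀ ℤ}
    (hu : u ∈ MC g.symmDigraph ℓ k) :
    lengthPart g.symmDigraph ℓ (boundary u) = diagonalBoundary g u := by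
  rw [MC_symmDigraph hℓ, Finsupp.supported_eq_span_single] at hu
  refine LinearMap.eqOn_span (f := lengthPart g.symmDigraph ℓ ∘ₗ boundary) ?_ hu
  rintro _ ⟨x, ⟨-, h1, h2, h3⟩, rfl⟩
  rw [LinearMap.comp_apply, diagonalBoundary_single, ← lengthPart_boundary_single h1 h2, h3]

/-- Control of the first entry is what lets the induction prepend a vertex without changing the step
that leads into the tail. -/
theorem insertion_mem : ∀ {x : List V}, x ∈ reachableTuples g → insertion g x ∈
    Finsupp.supported ℤ ℤ {w : List V | w.head? = x.head? ∧ w.length = x.length + 1 ∧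
      w ∈ reachableTuples g ∧ distLength g w = distLength g x} := by
  have hins : ∀ {x y : V} {l : List V}, x :: y :: l ∈ reachableTuples g → 2 ≤ g.dist x y →
      -Finsupp.single (x :: nextVertex g x y :: y :: l) (1 : ℤ) ∈
      Finsupp.supported ℤ ℤ {w : List V | w.head? = (x :: y :: l).head? ∧
        w.length = (x :: y :: l).length + 1 ∧ w ∈ reachableTuples g ∧
        distLength g w = distLength g (x :: y :: l)} := by
    intro x y l hx hd
    obtain ⟨⟨hr, hne⟩, hx'⟩ := List.isChain_cons_cons.mp hx
    obtain ⟨hv, hv'⟩ := nextVertex_spec hr hne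
    have hv1 := SimpleGraph.dist_eq_one_iff_adj.mpr hv
    refine neg_mem (Finsupp.single_mem_supported ℤ _ ⟨rfl, rfl, ?_, ?_⟩)
    · refine List.isChain_cons_cons.mpr ⟨⟨hv.reachable, hv.ne⟩,
        List.isChain_cons_cons.mpr ⟨⟨hv.symm.reachable.trans hr, ?_⟩, hx'⟩⟩
      intro h
      rw [h] at hv1
      omega
    · simp only [distLength]
      omega
  intro x
  induction x with
  | nil => exact fun _ => zero_mem _
  | cons x l ih =>
    intro hx
    match l with
    | [] => exact zero_mem _
    | [y] =>
      rw [insertion]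
      split_ifs with hd
      · exact hins hx hd
      · exact zero_mem _
    | y :: z :: l =>
      rw [insertion]
      split_ifs with hd
      · exact hins hx hd
      · obtain ⟨h1, hx'⟩ := List.isChain_cons_cons.mp hx
        refine neg_mem (consMap_mem x ?_ (ih hx'))
        rintro w ⟨hw1, hw2, hw3, hw4⟩
        match w with
        | [] => simp at hw1
        | a :: w =>
          obtain rfl : a = y := by simpa using hw1
          refine ⟨rfl, by simp at hw2 ⊢; omega, List.isChain_cons_cons.mpr ⟨h1, hw3⟩, ?_⟩
          rw [distLength, hw4]
          rfl
      · exact zero_mem _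

theorem insertionMap_mem {ℓ k : ℤ} (hℓ : 0 ≤ ℓ) {u : List V →₀ ℤ}
    (hu : u ∈ MC g.symmDigraph ℓ k) : insertionMap g u ∈ MC g.symmDigraph ℓ (k + 1) := by
  rw [MC_symmDigraph hℓ] at hu ⊢
  refine map_supported _ ?_ hu
  rintro x ⟨h1, h2, h3, h4⟩
  rw [insertionMap_single]
  refine Finsupp.supported_mono ?_ (insertion_mem h3)
  rintro w ⟨-, hw2, hw3, hw4⟩
  refine ⟨by omega, ?_, hw3, by omega⟩
  rintro rfl
  simp at hw2

theorem MC_eq_bot {ℓ k : ℤ} (hℓ : 0 ≤ ℓ) (h : ℓ < k) : MC g.symmDigraph ℓ k = ⊥ := by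
  rw [MC_symmDigraph hℓ, eq_bot_iff, ← Finsupp.supported_empty]
  refine Finsupp.supported_mono ?_
  rintro x ⟨h1, h2, h3, h4⟩
  have := length_le_distLength h3
  omega

/-! ### Reduction to alternating tuples -/

theorem alternating_length (n : ℕ) (x y : V) : (alternating n x y).length = n + 1 := by
  induction n generalizing x y with
  | zero => rfl
  | succ n ih => simp [alternating, ih]

theorem alternating_mem {x y : V} (h : g.Adj x y) (n : ℕ) :
    alternating n x y ∈ reachableTuples g ∧ distLength g (alternating n x y) = n := by
  induction n generalizing x y with
  | zero => exact ⟨List.IsChain.singleton x, rfl⟩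
  | succ n ih =>
    obtain ⟨h1, h2⟩ := ih h.symm
    have h3 := SimpleGraph.dist_eq_one_iff_adj.mpr h
    cases n with
    | zero => exact ⟨List.isChain_cons_cons.mpr ⟨⟨h.reachable, h.ne⟩, h1⟩, by
        simp [alternating, distLength, h3]⟩
    | succ n =>
      refine ⟨List.isChain_cons_cons.mpr ⟨⟨h.reachable, h.ne⟩, h1⟩, ?_⟩
      simp only [alternating, distLength] at h2 ⊢
      omega

theorem diagonalFaces_alternating {x y : V} (h : g.Adj x y) (n : ℕ) :
    diagonalFaces g (alternating n x y) = 0 := by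
  induction n generalizing x y with
  | zero => rfl
  | succ n ih =>
    have h1 := SimpleGraph.dist_eq_one_iff_adj.mpr h
    have h2 := ih h.symm
    cases n with
    | zero => rfl
    | succ n =>
      cases n <;> simp only [alternating] at h2 ⊢ <;> rw [diagonalFaces, h2] <;> simp <;> omega

/-- The tuple turns back at every inner entry, and its last step is an edge, so there is no place to
insert. -/
theorem insertion_alternating {x y : V} (h : g.Adj x y) (n : ℕ) :
    insertion g (alternating n x y) = 0 := by
  induction n generalizing x y with
  | zero => rfl
  | succ n ih =>
    have h1 := SimpleGraph.dist_eq_one_iff_adj.mpr h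
    have h2 := ih h.symm
    cases n with
    | zero => simp [alternating, insertion, h1]
    | succ n =>
      cases n <;> simp only [alternating] at h2 ⊢ <;> rw [insertion, h2] <;> simp [h1]

/-- In the range where geodesics are unique, cycles are homologous to combinations of alternating
tuples. -/
theorem cycle_sub_mem {i : ℕ} (hg : ((2 * i + 5 : ℕ) : ℕ∞) ≤ g.egirth) {ℓ k : ℤ} (hℓ : 1 ≤ ℓ)
    (hk : ℓ ≤ k + i) {u : List V →₀ ℤ} (hu : u ∈ MC g.symmDigraph ℓ k)
    (hu0 : diagonalBoundary g u = 0) :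
    u - diagonalBoundary g (insertionMap g u) ∈
      Finsupp.supported ℤ ℤ {x : List V | (x.length : ℤ) = k + 1 ∧ (distLength g x : ℤ) = ℓ ∧
        x ∈ alternatingTuples g} := by
  -- For a cycle the difference is the value of `id - ∂h - h∂`, which can be computed on tuples: it
  -- is zero off the alternating tuples and the identity on them.
  have h1 : u - diagonalBoundary g (insertionMap g u) = (LinearMap.id -
      diagonalBoundary g ∘ₗ insertionMap g - insertionMap g ∘ₗ diagonalBoundary g :
        (List V →₀ ℤ) →ₗ[ℤ] (List V →₀ ℤ)) u := by
    simp [hu0]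
  rw [h1]
  rw [MC_symmDigraph (by omega)] at hu
  refine map_supported _ ?_ hu
  rintro x ⟨hx1, hx2, hx3, hx4⟩
  match x with
  | [] => exact absurd rfl hx2
  | [x] => simp [distLength] at hx4; omega
  | x :: y :: l =>
    simp only [LinearMap.sub_apply, LinearMap.comp_apply, LinearMap.id_apply,
      diagonalBoundary_single, insertionMap_single]
    by_cases ha : x :: y :: l ∈ alternatingTuples g
    · have hs := Finsupp.single_mem_supported ℤ (1 : ℤ)
        (show x :: y :: l ∈ {x : List V | (x.length : ℤ) = k + 1 ∧ (distLength g x : ℤ) = ℓ ∧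
          x ∈ alternatingTuples g} from ⟨hx1, hx4, ha⟩)
      obtain ⟨n, a, b, hab, he⟩ := ha
      rw [he, diagonalFaces_alternating hab, insertion_alternating hab, map_zero, map_zero, sub_zero,
        sub_zero, ← he]
      exact hs
    · have hh := diagonal_homotopy hg l x y hx3 (by
        simp only [List.length_cons] at hx1
        push_cast at hx1
        omega) ha
      rw [← hh]
      simp

theorem homology_subsingleton {A B C : Type*} [AddCommGroup A] [AddCommGroup B] [AddCommGroup C]
    {f : A →ₗ[ℤ] B} {f' : B →ₗ[ℤ] C} (h : ∀ x, f' x = 0 → ∃ y, f y = x) :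
    Subsingleton (Homology f f') := by
  refine subsingleton_of_forall_eq 0 fun q => ?_
  obtain ⟨⟨x, hx⟩, rfl⟩ := Submodule.Quotient.mk_surjective _ q
  exact (Submodule.Quotient.mk_eq_zero _).mpr (h x hx)

/-- Off the diagonal no alternating tuple has the required length and number of entries, so every
cycle is the boundary of its insertion. -/
theorem MH_subsingleton {i j : ℕ} (hg : ((2 * i + 5 : ℕ) : ℕ∞) ≤ g.egirth) (hj : 1 ≤ j)
    (hji : j ≤ i) {ℓ : ℤ} (hℓ : 1 ≤ ℓ) : Subsingleton (MH g.symmDigraph ℓ (ℓ - j)) := by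
  refine homology_subsingleton ?_
  rintro ⟨u, hu⟩ hu0
  have h1 : lengthPart g.symmDigraph ℓ (boundary u) = 0 := congrArg Subtype.val hu0
  rw [lengthPart_boundary_eq (by omega) hu] at h1
  have h2 := cycle_sub_mem hg hℓ (by omega) hu h1
  have h3 : {x : List V | (x.length : ℤ) = ℓ - j + 1 ∧ (distLength g x : ℤ) = ℓ ∧
      x ∈ alternatingTuples g} = ∅ := by
    refine Set.eq_empty_of_forall_notMem ?_
    rintro _ ⟨hx1, hx2, n, x, y, hxy, rfl⟩
    rw [alternating_length] at hx1
    rw [(alternating_mem hxy n).2] at hx2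
    omega
  rw [h3, Finsupp.supported_empty, Submodule.mem_bot, sub_eq_zero] at h2
  have h4 := insertionMap_mem (by omega) hu
  refine ⟨⟨insertionMap g u, h4⟩, Subtype.ext ?_⟩
  change lengthPart g.symmDigraph ℓ (boundary (insertionMap g u)) = u
  rw [lengthPart_boundary_eq (by omega) h4, ← h2]

/-! ### The diagonal as a complex of oriented edges -/

/-- On the diagonal there are no boundaries, so that homology classes are cycles. -/
theorem MH_mk_eq_iff {ℓ : ℤ} (hℓ : 0 ≤ ℓ)
    (a b : LinearMap.ker (magBoundary g.symmDigraph ℓ (sub_add_cancel ℓ 1))) :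
    (Submodule.Quotient.mk a : MH g.symmDigraph ℓ ℓ) = Submodule.Quotient.mk b ↔
      (a.1.1 : List V →₀ ℤ) = b.1.1 := by
  rw [Submodule.Quotient.eq]
  constructor
  · rintro ⟨⟨v, hv⟩, h⟩
    rw [MC_eq_bot hℓ (by omega), Submodule.mem_bot] at hv
    subst hv
    have h1 := congrArg Subtype.val h
    change lengthPart g.symmDigraph ℓ (boundary 0) = a.1.1 - b.1.1 at h1
    rw [map_zero, map_zero] at h1
    exact (sub_eq_zero.mp h1.symm)
  · intro h
    have h1 : a - b = 0 := sub_eq_zero.mpr (Subtype.ext (Subtype.ext h))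
    rw [h1]
    exact zero_mem _

/-- The linear extension of `alternating n` to chains of pairs of vertices. -/
noncomputable def alternatingChain (n : ℕ) : ((V × V) →₀ ℤ) →ₗ[ℤ] (List V →₀ ℤ) :=
  Finsupp.lmapDomain ℤ ℤ fun e => alternating n e.1 e.2

/-- The linear extension of the reversal of pairs. -/
noncomputable def swapChain : ((V × V) →₀ ℤ) →ₗ[ℤ] ((V × V) →₀ ℤ) :=
  Finsupp.lmapDomain ℤ ℤ Prod.swap

variable (g) in
/-- The chains of oriented edges. -/
noncomputable def edgeChains : Submodule ℤ ((V × V) →₀ ℤ) :=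
  Finsupp.supported ℤ ℤ {e | g.Adj e.1 e.2}

theorem alternatingChain_single (n : ℕ) (e : V × V) (c : ℤ) :
    alternatingChain n (Finsupp.single e c) = Finsupp.single (alternating n e.1 e.2) c := by
  simp [alternatingChain, Finsupp.mapDomain_single]

theorem swapChain_apply (c : (V × V) →₀ ℤ) (x y : V) : swapChain c (x, y) = c (y, x) :=
  Finsupp.mapDomain_apply Prod.swap_injective c (y, x)

/-- The first two entries recover the edge. With a single entry this fails, which is why `ℓ = 1`,
whose `∂'` lands on vertices, is exceptional. -/
theorem alternatingChain_injective (n : ℕ) :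
    Function.Injective (alternatingChain (V := V) (n + 1)) := by
  refine Finsupp.mapDomain_injective ?_
  rintro ⟨x, y⟩ ⟨x', y'⟩ h
  cases n <;> simp [alternating] at h <;> simp [h.1, h.2]

theorem map_edgeChains {M : Type*} [AddCommGroup M] {f : ((V × V) →₀ ℤ) →ₗ[ℤ] M}
    {N : Submodule ℤ M} (h : ∀ x y, g.Adj x y → f (Finsupp.single (x, y) 1) ∈ N)
    {c : (V × V) →₀ ℤ} (hc : c ∈ edgeChains g) : f c ∈ N := by
  rw [edgeChains, Finsupp.supported_eq_span_single] at hc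
  have : Submodule.span ℤ ((fun e => Finsupp.single e (1 : ℤ)) '' {e : V × V | g.Adj e.1 e.2}) ≤
      N.comap f := by
    rw [Submodule.span_le]
    rintro _ ⟨⟨x, y⟩, hxy, rfl⟩
    exact h x y hxy
  exact this hc

theorem eq_on_edgeChains {M : Type*} [AddCommGroup M] {f f' : ((V × V) →₀ ℤ) →ₗ[ℤ] M}
    (h : ∀ x y, g.Adj x y → f (Finsupp.single (x, y) 1) = f' (Finsupp.single (x, y) 1))
    {c : (V × V) →₀ ℤ} (hc : c ∈ edgeChains g) : f c = f' c := by
  have := map_edgeChains (f := f - f') (N := ⊥) (fun x y hxy => by simp [h x y hxy]) hc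
  exact sub_eq_zero.mp this

theorem swapChain_mem {c : (V × V) →₀ ℤ} (hc : c ∈ edgeChains g) : swapChain c ∈ edgeChains g := by
  refine map_edgeChains (fun x y hxy => ?_) hc
  simp only [swapChain, Finsupp.lmapDomain_apply, Finsupp.mapDomain_single]
  exact Finsupp.single_mem_supported ℤ _ hxy.symm

theorem alternatingChain_mem {ℓ : ℤ} {n : ℕ} (hn : (n : ℤ) = ℓ) {c : (V × V) →₀ ℤ}
    (hc : c ∈ edgeChains g) : alternatingChain n c ∈ MC g.symmDigraph ℓ ℓ := by
  rw [MC_symmDigraph (by omega)]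
  refine map_edgeChains (fun x y hxy => ?_) hc
  obtain ⟨h1, h2⟩ := alternating_mem hxy n
  have h3 := alternating_length n x y
  rw [alternatingChain_single]
  refine Finsupp.single_mem_supported ℤ _ ⟨by rw [h3]; omega, ?_, h1, by rw [h2]; exact hn⟩
  intro h
  rw [show alternating n x y = [] from h] at h3
  simp at h3

theorem lengthPart_boundary_alternatingChain {ℓ : ℤ} {n : ℕ} (hn : (n : ℤ) = ℓ)
    {c : (V × V) →₀ ℤ} (hc : c ∈ edgeChains g) :
    lengthPart g.symmDigraph ℓ (boundary (alternatingChain n c)) = 0 := by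
  rw [lengthPart_boundary_eq (by omega) (alternatingChain_mem hn hc)]
  refine eq_on_edgeChains (f := diagonalBoundary g ∘ₗ alternatingChain n) (f' := 0)
    (fun x y hxy => ?_) hc
  rw [LinearMap.comp_apply, alternatingChain_single, diagonalBoundary_single,
    diagonalFaces_alternating hxy, LinearMap.zero_apply]

/-- This is the case `i = 0` of `cycle_sub_mem`: the insertion of a diagonal chain has more steps
than its length allows, hence is zero, and the cycle itself is alternating. -/
theorem exists_alternatingChain_eq (hg : ((5 : ℕ) : ℕ∞) ≤ g.egirth) {ℓ : ℤ} {n : ℕ}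
    (hn : (n : ℤ) = ℓ) (hℓ : 1 ≤ ℓ) {u : List V →₀ ℤ} (hu : u ∈ MC g.symmDigraph ℓ ℓ)
    (hu0 : lengthPart g.symmDigraph ℓ (boundary u) = 0) :
    ∃ c ∈ edgeChains g, alternatingChain n c = u := by
  rw [lengthPart_boundary_eq (by omega) hu] at hu0
  have h1 := cycle_sub_mem (i := 0) hg hℓ (by simp) hu hu0
  have h2 := insertionMap_mem (by omega) hu
  rw [MC_eq_bot (by omega) (by omega), Submodule.mem_bot] at h2
  rw [h2, map_zero, sub_zero, Finsupp.supported_eq_span_single] at h1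
  have h3 : Submodule.span ℤ ((fun x => Finsupp.single x (1 : ℤ)) ''
      {x : List V | (x.length : ℤ) = ℓ + 1 ∧ (distLength g x : ℤ) = ℓ ∧
        x ∈ alternatingTuples g}) ≤ (edgeChains g).map (alternatingChain n) := by
    rw [Submodule.span_le]
    rintro _ ⟨_, ⟨hx1, -, m, x, y, hxy, rfl⟩, rfl⟩
    rw [alternating_length] at hx1
    obtain rfl : m = n := by omega
    exact ⟨Finsupp.single (x, y) 1, Finsupp.single_mem_supported ℤ _ hxy,
      alternatingChain_single _ _ _⟩
  exact h3 h1

/-- Removing an inner entry leaves two equal neighbours, so only the first and the last face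
survive. -/
theorem boundary_alternating {x y : V} (h : x ≠ y) (n : ℕ) :
    boundary (Finsupp.single (alternating (n + 1) x y) 1) =
      Finsupp.single (alternating n y x) 1 +
        (-1 : ℤ) ^ (n + 1) • Finsupp.single (alternating n x y) 1 := by
  have hreg : ∀ (n : ℕ) {x y : V}, x ≠ y → alternating n x y ∈ regularTuples V := by
    intro n
    induction n with
    | zero => exact fun _ => List.IsChain.singleton _
    | succ n ih =>
      intro x y h
      cases n with
      | zero => exact List.isChain_cons_cons.mpr ⟨h, List.IsChain.singleton _⟩
      | succ n => exact List.isChain_cons_cons.mpr ⟨h, ih h.symm⟩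
  -- Degenerate tuples stay degenerate under prepending, so they may be dropped from the tail
  -- beforehand.
  have hcons : ∀ (x : V) (u : List V →₀ ℤ), proj (regularTuples V) (consMap x u) =
      proj (regularTuples V) (consMap x (proj (regularTuples V) u)) := by
    intro x u
    refine LinearMap.congr_fun (f := proj (regularTuples V) ∘ₗ consMap x)
      (g := proj (regularTuples V) ∘ₗ consMap x ∘ₗ proj (regularTuples V))
      (linearMap_ext_single fun l => ?_) u
    simp only [LinearMap.comp_apply]
    by_cases hl : l ∈ regularTuples V
    · rw [proj_single_mem hl]
    · rw [proj_single_notMem hl, consMap_single, map_zero, map_zero,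
        proj_single_notMem (show x :: l ∉ regularTuples V from
          fun h => hl (List.isChain_cons.mp h).2)]
  rw [boundary, LinearMap.comp_apply]
  induction n generalizing x y with
  | zero =>
    simp only [alternating]
    rw [preBoundary_cons_single, preBoundary_cons_single, preBoundary_nil, map_zero, sub_zero, map_sub, consMap_single]
    change proj (regularTuples V) (Finsupp.single (alternating 0 y x) 1) -
      proj (regularTuples V) (Finsupp.single (alternating 0 x y) 1) = _
    rw [proj_single_mem (hreg 0 h.symm), proj_single_mem (hreg 0 h)]
    simp [sub_eq_add_neg, alternating]
  | succ n ih =>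
    have hdeg : x :: alternating n x y ∉ regularTuples V := by
      cases n <;> exact fun h => (List.isChain_cons_cons.mp h).1 rfl
    have hreg' : x :: alternating n y x ∈ regularTuples V := hreg (n + 1) h
    rw [alternating, preBoundary_cons_single, map_sub, hcons, ih h.symm,
      proj_single_mem (hreg (n + 1) h.symm)]
    simp only [map_add, map_smul, consMap_single]
    rw [proj_single_notMem hdeg, proj_single_mem hreg', zero_add, sub_eq_add_neg, ← neg_smul,
      pow_succ _ (n + 1), mul_neg_one]
    rfl

/-- Both surviving faces have length exactly one less, so nothing is lost in the projection, and
`∂'` becomes `σ + (-1) ^ (n + 1)` on edge chains. -/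
theorem lengthPart_boundary_alternatingChain_succ {ℓ : ℤ} {n : ℕ} (hn : (n : ℤ) = ℓ)
    {c : (V × V) →₀ ℤ} (hc : c ∈ edgeChains g) :
    lengthPart g.symmDigraph ℓ (boundary (alternatingChain (n + 1) c)) =
      alternatingChain n (swapChain c + (-1 : ℤ) ^ (n + 1) • c) := by
  have h1 : boundary (alternatingChain (n + 1) c) =
      alternatingChain n (swapChain c + (-1 : ℤ) ^ (n + 1) • c) := by
    refine eq_on_edgeChains (f := boundary ∘ₗ alternatingChain (n + 1))
      (f' := alternatingChain n ∘ₗ (swapChain + (-1 : ℤ) ^ (n + 1) • LinearMap.id))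
      (fun x y hxy => ?_) hc
    simp only [LinearMap.comp_apply, alternatingChain_single, boundary_alternating hxy.ne,
      LinearMap.add_apply, LinearMap.smul_apply, LinearMap.id_apply, map_add, map_smul]
    simp [swapChain, Finsupp.mapDomain_single, alternatingChain_single]
  have h2 := alternatingChain_mem hn
    (add_mem (swapChain_mem hc) (Submodule.smul_mem _ ((-1 : ℤ) ^ (n + 1)) hc))
  have h3 := sub_proj_mem (s := {x | tupleLength g.symmDigraph x = (ℓ : WithTop ℤ)}) (t' := ∅)
    (fun x hx hx' => hx' hx.2.2) h2
  rw [Finsupp.supported_empty, Submodule.mem_bot, sub_eq_zero] at h3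
  rw [h1]
  exact h3.symm

/-- No edge is its own reversal, so the edge chains are free over the group ring of the group of
order two, and `σ + 1` and `σ - 1` are each other's kernel and image. -/
theorem dMH_diagonal_subsingleton (hg : ((5 : ℕ) : ℕ∞) ≤ g.egirth) {ℓ : ℤ} (hℓ : 2 ≤ ℓ) :
    Subsingleton (dMH g.symmDigraph ℓ ℓ) := by
  classical
  -- Here `ℓ = n + 2`, so `∂'` lands in degree `n + 1 ≥ 1`, where `alternatingChain` is injective.
  obtain ⟨n, hn⟩ : ∃ n : ℕ, ((n + 1 : ℕ) : ℤ) = ℓ - 1 := ⟨(ℓ - 2).toNat, by omega⟩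
  have hn1 : ((n + 2 : ℕ) : ℤ) = ℓ := by omega
  have hn2 : ((n + 3 : ℕ) : ℤ) = ℓ + 1 := by omega
  refine homology_subsingleton fun q hq => ?_
  obtain ⟨⟨⟨u, hu⟩, hu0⟩, rfl⟩ := Submodule.Quotient.mk_surjective _ q
  have h1 : lengthPart g.symmDigraph (ℓ - 1) (boundary u) = 0 :=
    (MH_mk_eq_iff (by omega) _ 0).mp hq
  obtain ⟨c, hc, rfl⟩ := exists_alternatingChain_eq hg hn1 (by omega) hu
    (congrArg Subtype.val hu0)
  rw [lengthPart_boundary_alternatingChain_succ hn hc] at h1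
  have h2 := alternatingChain_injective n (h1.trans (map_zero _).symm)
  have hsym : ∀ x y, c (y, x) + (-1 : ℤ) ^ (n + 2) * c (x, y) = 0 := by
    intro x y
    have := DFunLike.congr_fun h2 (x, y)
    simpa [swapChain_apply] using this
  have hdiag : ∀ x, c (x, x) = 0 := fun x =>
    (Finsupp.mem_supported' ℤ c).mp hc _ (fun h => g.loopless.irrefl x h)
  -- An arbitrary order selects one orientation of each edge. The (anti)symmetric chain `c` is
  -- determined by its selected half, and the reversal `b` of that half is a preimage.
  let : LinearOrder V := linearOrderOfSTO (WellOrderingRel (α := V))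
  set b := swapChain (c.filter fun e => e.1 < e.2) with hb
  have hc' : (c.filter fun e : V × V => e.1 < e.2) ∈ edgeChains g := by
    refine (Finsupp.mem_supported' ℤ _).mpr fun e he => ?_
    rw [Finsupp.filter_apply, (Finsupp.mem_supported' ℤ c).mp hc e he, ite_self]
  have hbmem : b ∈ edgeChains g := swapChain_mem hc'
  have hbc : swapChain b + (-1 : ℤ) ^ (n + 3) • b = c := by
    ext ⟨x, y⟩
    have hs := hsym y x
    rw [Finsupp.add_apply, Finsupp.smul_apply, hb, swapChain_apply, swapChain_apply,
      swapChain_apply, Finsupp.filter_apply, Finsupp.filter_apply, smul_eq_mul]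
    rcases lt_trichotomy x y with h | rfl | h
    · simp [h, h.not_gt]
    · simp [hdiag]
    · simp only [h, h.not_gt, if_true, if_false]
      rw [pow_succ]
      linarith
  refine ⟨Submodule.Quotient.mk ⟨⟨alternatingChain (n + 3) b, alternatingChain_mem hn2 hbmem⟩,
    Subtype.ext (lengthPart_boundary_alternatingChain hn2 hbmem)⟩, ?_⟩
  refine (MH_mk_eq_iff (by omega) _ _).mpr ?_
  change lengthPart g.symmDigraph ℓ (boundary (alternatingChain (n + 3) b)) = _
  rw [lengthPart_boundary_alternatingChain_succ hn1 hbmem, hbc]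

/-! ### Closed walks and degree one -/

/-- The chain of the darts of a walk. -/
noncomputable def walkChain : ∀ {x y : V}, g.Walk x y → ((V × V) →₀ ℤ)
  | _, _, .nil => 0
  | x, _, .cons (v := v) _ p => Finsupp.single (x, v) 1 + walkChain p

theorem walkChain_mem : ∀ {x y : V} (p : g.Walk x y), walkChain p ∈ edgeChains g
  | _, _, .nil => zero_mem _
  | _, _, .cons h p => add_mem (Finsupp.single_mem_supported ℤ _ h) (walkChain_mem p)

/-- The boundary of a walk telescopes; for a closed walk it vanishes. -/
theorem alternatingChain_walkChain : ∀ {x y : V} (p : g.Walk x y),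
    alternatingChain 0 (swapChain (walkChain p) + (-1 : ℤ) ^ (0 + 1) • walkChain p) =
      Finsupp.single [y] 1 - Finsupp.single [x] 1
  | _, _, .nil => by simp [walkChain]
  | x, y, .cons (v := v) h p => by
    have ih := alternatingChain_walkChain p
    simp only [map_add, map_smul, walkChain] at ih ⊢
    simp only [swapChain, Finsupp.lmapDomain_apply, Finsupp.mapDomain_single, smul_add,
      alternatingChain_single, Prod.swap, alternating] at ih ⊢
    rw [add_add_add_comm, ih]
    simp only [zero_add, pow_one, neg_smul, one_smul]
    abel

theorem walkChain_apply_of_notMem {a b : V} : ∀ {x y : V} (p : g.Walk x y), s(a, b) ∉ p.edges →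
    walkChain p (a, b) = 0
  | _, _, .nil, _ => by simp [walkChain]
  | x, y, .cons (v := v) h p, hab => by
    rw [SimpleGraph.Walk.edges_cons, List.mem_cons, not_or] at hab
    rw [walkChain, Finsupp.add_apply, walkChain_apply_of_notMem p hab.2, Finsupp.single_eq_of_ne]
    · simp
    · intro h0
      apply hab.1
      rw [Prod.mk.injEq] at h0
      rw [h0.1, h0.2]

/-- Classes hit from degree two are symmetric under reversal, while a cycle of the graph gives a
closed chain that is not. -/
theorem dMH_one_nontrivial (hg : ((5 : ℕ) : ℕ∞) ≤ g.egirth) (hc : g.egirth ≠ ⊤) :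
    Nontrivial (dMH g.symmDigraph 1 1) := by
  classical
  rw [Ne, SimpleGraph.egirth_eq_top] at hc
  obtain ⟨a, w, hw, -⟩ := SimpleGraph.exists_egirth_eq_length.mpr hc
  have hz := walkChain_mem w
  have hz0 : lengthPart g.symmDigraph (1 - 1) (boundary (alternatingChain 1 (walkChain w))) = 0 := by
    rw [lengthPart_boundary_alternatingChain_succ (n := 0) (by simp) hz, alternatingChain_walkChain,
      sub_self]
  -- The first edge of a cycle does not recur in the rest, so it is traversed in one direction only.
  have hasym : ¬∀ x y, walkChain w (x, y) = walkChain w (y, x) := by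
    cases w with
    | nil => exact absurd hw SimpleGraph.Walk.not_isCycle_nil
    | cons h p =>
      rename_i v
      have h1 := (SimpleGraph.Walk.cons_isCycle_iff p h).mp hw
      intro hs
      have h2 := hs a v
      rw [walkChain, Finsupp.add_apply, Finsupp.add_apply, walkChain_apply_of_notMem p h1.2,
        walkChain_apply_of_notMem p (by rw [Sym2.eq_swap]; exact h1.2)] at h2
      rw [Finsupp.single_eq_same, Finsupp.single_eq_of_ne] at h2
      · simp at h2
      · intro h0
        exact h.ne (Prod.mk.inj h0).2
  set q : MH g.symmDigraph 1 1 := Submodule.Quotient.mk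
    ⟨⟨alternatingChain 1 (walkChain w), alternatingChain_mem (by simp) hz⟩,
      Subtype.ext (lengthPart_boundary_alternatingChain (by simp) hz)⟩ with hq
  have hq0 : magDifferential g.symmDigraph (sub_add_cancel 1 1) (sub_add_cancel 1 1) q = 0 :=
    (MH_mk_eq_iff (by omega) _ 0).mpr hz0
  refine nontrivial_of_ne (Submodule.Quotient.mk ⟨q, hq0⟩) 0 fun h => ?_
  obtain ⟨r, hr⟩ := (Submodule.Quotient.mk_eq_zero _).mp h
  obtain ⟨⟨⟨v, hv⟩, hv0⟩, rfl⟩ := Submodule.Quotient.mk_surjective _ r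
  have h1 : lengthPart g.symmDigraph 1 (boundary v) = alternatingChain 1 (walkChain w) :=
    (MH_mk_eq_iff (by omega) _ _).mp hr
  obtain ⟨c, hc, rfl⟩ := exists_alternatingChain_eq (n := 2) hg (by simp) (by omega) hv
    (congrArg Subtype.val hv0)
  rw [lengthPart_boundary_alternatingChain_succ (by simp) hc] at h1
  have h2 := alternatingChain_injective 0 h1
  refine hasym fun x y => ?_
  -- The sign of the incoming map is `(-1) ^ 2 = 1`, so the chain equals `σ c + c`.
  rw [← h2]
  simp only [Finsupp.add_apply, Finsupp.smul_apply, swapChain_apply]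
  norm_num
  ring

end PathMag

theorem mainTheorem11 {V : Type*} [Finite V] (g : SimpleGraph V) (ℓ i : ℕ) (hℓ : 1 ≤ ℓ)
    (hg : ((2 * i + 5 : ℕ) : ℕ∞) ≤ g.egirth) :
    (2 ≤ ℓ → Subsingleton (PathMag.dMH g.symmDigraph (ℓ : ℤ) (ℓ : ℤ))) ∧
    (∀ j : ℕ, 1 ≤ j → j ≤ i →
      Subsingleton (PathMag.dMH g.symmDigraph (ℓ : ℤ) ((ℓ : ℤ) - (j : ℤ)))) ∧
    (g.egirth ≠ ⊤ → Nontrivial (PathMag.dMH g.symmDigraph 1 1)) := by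
  have hg5 : ((5 : ℕ) : ℕ∞) ≤ g.egirth := le_trans (Nat.cast_le.mpr (by omega)) hg
  refine ⟨fun h => PathMag.dMH_diagonal_subsingleton hg5 (by omega), fun j hj hji => ?_,
    PathMag.dMH_one_nontrivial hg5⟩
  -- Here the magnitude homology is itself zero, hence so is its subquotient.
  have := PathMag.MH_subsingleton hg hj hji (ℓ := ℓ) (by omega)
  exact PathMag.homology_subsingleton fun x _ => ⟨0, Subsingleton.elim _ _⟩
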